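/- Let $\mathcal A$ be a small abelian category and $\mathcal B\subset\mathcal A$ a strictly full abelian subcategory which is closed under taking subobjects and quotients in $\mathcal A$ and such that each object of $\mathcal A$ is an extension of two objects of $\mathcal B$. For a small abelian category $\mathcal C$ write $\operatorname{Pro}(\mathcal C)=\operatorname{Ind}(\mathcal C^{op})^{op}$, and denote by $i$ both the inclusion $\mathcal B\to\mathcal A$ and the induced functor $\operatorname{Pro}(\mathcal B)\to\operatorname{Pro}(\mathcal A)$. Let $j:\mathcal A\to\operatorname{Pro}(\mathcal B)$ be the additive functor $$j(X)=\text{``}\varprojlim\text{''}\; Y,\qquad\text{over the subobjects } Y\subset X \text{ with } Y\in\mathcal B \text{ and } X/Y\in\mathcal B,$$ with its canonical morphisms $i(j(X))\to X$. The inclusion $\operatorname{incl}:\operatorname{Fun}^{\mathrm{rex}}(\mathcal A,\operatorname{Pro}(\mathcal B))\to\operatorname{Fun}^{\mathrm{add}}(\mathcal A,\operatorname{Pro}(\mathcal B))$ of right exact functors into additive functors has a right adjoint $\operatorname{incl}^R$; put $\widetilde j=\operatorname{incl}^R(j)$, with its canonical morphism (the counit) $\widetilde j\to j$. Let $\mathcal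 C_{\mathcal A,\mathcal B}$ be the category of quadruples $(X,Y,u,v)$ with $X\in\mathcal A$, $Y\in\mathcal B$, $u:i(Y)\to X$ in $\mathcal A$ and $v:\widetilde j(X)\to Y$ in $\operatorname{Pro}(\mathcal B)$, such that the composition $\widetilde j(i(Y))\xrightarrow{\widetilde j(u)}\widetilde j(X)\xrightarrow{v}Y$ is zero and the compositions $i(\widetilde j(X))\xrightarrow{i(v)}i(Y)\xrightarrow{u}X$ and $i(\widetilde j(X))\to i(j(X))\to X$ are equal in $\operatorname{Pro}(\mathcal A)$; a morphism $(X,Y,u,v)\to(X',Y',u',v')$ is a pair of morphisms $X\to X'$ and $Y\to Y'$ commuting with $u,u'$ and with $v,v'$. Let $\beta:\mathcal B\to\mathcal C_{\mathcal A,\mathcal B}$, $\beta(Y)=(0,Y,0,0)$, and let $\pi:\mathcal C_{\mathcal A,\mathcal B}\to\mathcal A$, $\pi(X,Y,u,v)=X$. Then the category $\mathcal C_{\mathcal A,\mathcal B}$ is abelian, and the full subcategory $\beta(\mathcal B)\subset\mathcal C_{\mathcal A,\mathcal B}$ (the essential image of $\beta$) is a Serre subcategory, i.e. it contains zero and is closed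 under taking subobjects, quotients and extensions. The functor $\pi$ sends every morphism whose kernel and cokernel lie in $\beta(\mathcal B)$ to an isomorphism, and the induced functor from the Serre quotient (the localization of $\mathcal C_{\mathcal A,\mathcal B}$ at these morphisms) is an equivalence $$\overline\pi:\mathcal C_{\mathcal A,\mathcal B}/\beta(\mathcal B)\xrightarrow{\ \sim\ }\mathcal A.$$ -/

import Mathlib

open CategoryTheory CategoryTheory.Limits

universe u

noncomputable section

namespace Devissage

/-! ### Pro-objects -/

section ProObjects

/-- The category of pro-objects of a small category, as the opposite of the category of
ind-objects of the opposite category. -/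
abbrev Pro (C : Type u) [SmallCategory C] : Type (u + 1) := (Ind Cᵒᵖ)ᵒᵖ

/-- The embedding of `C` in `Pro C` as the constant pro-objects. -/
abbrev Pro.of (C : Type u) [SmallCategory C] : C ⥤ Pro C := (Ind.yoneda (C := Cᵒᵖ)).rightOp

instance Pro.additive_of (C : Type u) [SmallCategory C] [Abelian C] : (Pro.of C).Additive := by
  have : (Ind.yoneda (C := Cᵒᵖ)).Additive := Functor.additive_of_preserves_binary_products _
  constructor
  intro X Y f g
  change (Ind.yoneda.map (f + g).op).op = (Ind.yoneda.map f.op).op + (Ind.yoneda.map g.op).op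
  rw [op_add, Functor.map_add, op_add]

/-- The functor `Pro C ⥤ Pro D` induced by `F : C ⥤ D`, sending `"lim" Xᵢ` to `"lim" F(Xᵢ)`:
its value on a pro-object `T` is the limit in `Pro D` of the constant pro-objects `F(c)` over all
morphisms from `T` to an object `c` of `C` (the indexing diagram of a presentation of `T` is
initial among these). -/
def Pro.map {C D : Type u} [SmallCategory C] [SmallCategory D] [Abelian D] (F : C ⥤ D) :
    Pro C ⥤ Pro D :=
  (Pro.of C).pointwiseRightKanExtension (F ⋙ Pro.of D)

/-- The canonical identification of `Pro.map F` with `F` on constant pro-objects. -/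
def Pro.ofCompMap {C D : Type u} [SmallCategory C] [SmallCategory D] [Abelian D] (F : C ⥤ D) :
    Pro.of C ⋙ Pro.map F ⟶ F ⋙ Pro.of D :=
  (Pro.of C).pointwiseRightKanExtensionCounit (F ⋙ Pro.of D)

instance Pro.isIso_ofCompMap {C D : Type u} [SmallCategory C] [SmallCategory D] [Abelian D]
    (F : C ⥤ D) : IsIso (Pro.ofCompMap F) :=
  ((Pro.of C).pointwiseRightKanExtensionIsPointwiseRightKanExtension (F ⋙ Pro.of D)).isIso_hom

end ProObjects

/-! ### The pair `B ⊆ A` -/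

/-- A strictly full abelian subcategory of an abelian category `A` (given by a property `B` of
objects of `A`) which is closed under subobjects and quotients and such that each object of `A`
is an extension of two objects of `B`. -/
class IsTwoStepSubcategory {A : Type u} [SmallCategory A] [Abelian A] (B : ObjectProperty A) :
    Prop extends B.ContainsZero, B.IsClosedUnderFiniteProducts, B.IsClosedUnderSubobjects,
      B.IsClosedUnderQuotients where
  exists_extension (X : A) : ∃ (Y Z : A) (f : Y ⟶ X) (g : X ⟶ Z) (w : f ≫ g = 0),
    B Y ∧ B Z ∧ (ShortComplex.mk f g w).ShortExact

section

variable {A : Type u} [SmallCategory A] [Abelian A] (B : ObjectProperty A)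
  [IsTwoStepSubcategory B]

/-- The poset of subobjects `Z ⊆ X` such that `Z ∈ B` and `X/Z ∈ B`. -/
abbrev Adm (X : A) : Type u :=
  { Z : Subobject X // B (Z : A) ∧ B (cokernel Z.arrow) }

lemma factors_of_comp_cokernel_π {X T : A} (Z : Subobject X) (f : T ⟶ X)
    (h : f ≫ cokernel.π Z.arrow = 0) : Z.Factors f := by
  have := Subobject.factors_comp_arrow (P := Z) (Abelian.monoLift Z.arrow f h)
  rwa [Abelian.monoLift_comp] at this

lemma Adm.exists_of_hom {X Q : A} (W : Subobject X) (hW : B (W : A)) (hQ : B Q) (g : X ⟶ Q)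
    (h : kernelSubobject g ≤ W) : ∃ Z : Adm B X, Z.1 ≤ W ∧ Z.1.arrow ≫ g = 0 := by
  refine ⟨⟨kernelSubobject g, B.prop_of_mono (Subobject.ofLE _ _ h) hW, ?_⟩, h, by simp⟩
  have hg : B (Abelian.coimage g) := B.prop_of_mono (Abelian.factorThruCoimage g) hQ
  have w : kernel.ι g ≫ cokernel.π (kernelSubobject g).arrow = 0 := by
    rw [← kernelSubobject_arrow', Category.assoc, cokernel.condition, comp_zero]
  let q : Abelian.coimage g ⟶ cokernel (kernelSubobject g).arrow := cokernel.desc _ _ w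
  have : Epi (cokernel.π (kernel.ι g) ≫ q) := by
    rw [cokernel.π_desc]
    infer_instance
  have : Epi q := epi_of_epi (cokernel.π (kernel.ι g)) q
  exact B.prop_of_epi q hg

/-- Every admissible subobject contains an admissible one that is killed by a given morphism to
an object of `B`. -/
lemma Adm.exists_le {X Q : A} (W : Adm B X) (hQ : B Q) (g : X ⟶ Q) :
    ∃ Z : Adm B X, Z ≤ W ∧ Z.1.arrow ≫ g = 0 := by
  let g' : X ⟶ cokernel W.1.arrow ⨯ Q := prod.lift (cokernel.π W.1.arrow) g
  have h : kernelSubobject g' ≤ W.1 := by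
    apply Subobject.le_of_factors
    apply factors_of_comp_cokernel_π
    have := kernelSubobject_arrow_comp g' =≫ prod.fst
    rwa [Category.assoc, prod.lift_fst, zero_comp] at this
  obtain ⟨Z, hZ, hZ'⟩ := Adm.exists_of_hom B W.1 W.2.1 (B.prop_prod _ _ W.2.2 hQ) g' h
  refine ⟨Z, hZ, ?_⟩
  have := hZ' =≫ prod.snd
  rwa [Category.assoc, prod.lift_snd, zero_comp] at this

instance Adm.nonempty (X : A) : Nonempty (Adm B X) := by
  obtain ⟨Y, Z, f, g, w, hY, hZ, h⟩ := IsTwoStepSubcategory.exists_extension (B := B) X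
  have : Mono f := h.mono_f
  obtain ⟨Z, -⟩ := Adm.exists_of_hom B (Subobject.mk f)
    (B.prop_of_iso (Subobject.underlyingIso f).symm hY) hZ g (by
      apply Subobject.le_of_factors
      rw [Subobject.mk_factors_iff]
      exact ⟨h.exact.lift _ (kernelSubobject_arrow_comp g), h.exact.lift_f _ _⟩)
  exact ⟨Z⟩

/-- The diagram `Z ↦ Z`, indexed by the subobjects `Z ⊆ X` with `Z ∈ B` and `X/Z ∈ B`. -/
def Adm.diagram (X : A) : Adm B X ⥤ B.FullSubcategory :=
  B.lift ((Subtype.mono_coe _).functor ⋙ Subobject.underlying) (fun Z => Z.2.1)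

/-- The restriction of `f : X ⟶ X'` to admissible subobjects `Z ⊆ X` and `Z' ⊆ X'` such
that `f(Z) ⊆ Z'`. -/
def Adm.res {X X' : A} (f : X ⟶ X') (Z : Adm B X) (Z' : Adm B X')
    (h : Z'.1.Factors (Z.1.arrow ≫ f)) :
    (Adm.diagram B X).obj Z ⟶ (Adm.diagram B X').obj Z' :=
  B.homMk (Z'.1.factorThru _ h)

/-- The inclusion of an admissible subobject. -/
def Adm.arrow {X : A} (Z : Adm B X) : ((Adm.diagram B X).obj Z).obj ⟶ X := Z.1.arrow

instance {X : A} (Z : Adm B X) : Mono (Adm.arrow B Z) :=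
  inferInstanceAs (Mono Z.1.arrow)

lemma Adm.res_arrow {X X' : A} (f : X ⟶ X') (Z : Adm B X) (Z' : Adm B X')
    (h : Z'.1.Factors (Z.1.arrow ≫ f)) :
    (Adm.res B f Z Z' h).hom ≫ Adm.arrow B Z' = Adm.arrow B Z ≫ f :=
  Subobject.factorThru_arrow Z'.1 (Z.1.arrow ≫ f) h

lemma Adm.diagram_map_arrow {X : A} {Z Z' : Adm B X} (h : Z ⟶ Z') :
    ((Adm.diagram B X).map h).hom ≫ Adm.arrow B Z' = Adm.arrow B Z :=
  Subobject.ofLE_arrow (leOfHom h)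

lemma Adm.hom_ext {X : A} {Y : B.FullSubcategory} {Z : Adm B X}
    {a b : Y ⟶ (Adm.diagram B X).obj Z}
    (h : a.hom ≫ Adm.arrow B Z = b.hom ≫ Adm.arrow B Z) : a = b :=
  B.ι.map_injective ((cancel_mono (Adm.arrow B Z)).1 h)

/-- For `f : X ⟶ X'`, each admissible subobject of `X'` contains the image of arbitrarily
small admissible subobjects of `X`. -/
lemma Adm.exists_factors {X X' : A} (f : X ⟶ X') (W : Adm B X) (Z' : Adm B X') :
    ∃ Z : Adm B X, Z ≤ W ∧ Z'.1.Factors (Z.1.arrow ≫ f) := by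
  obtain ⟨Z, hZ, hZ'⟩ := Adm.exists_le B W Z'.2.2 (f ≫ cokernel.π Z'.1.arrow)
  exact ⟨Z, hZ, factors_of_comp_cokernel_π _ _ (by simpa using hZ')⟩

lemma Adm.exists_le_le {X : A} (Z₁ Z₂ : Adm B X) : ∃ Z : Adm B X, Z ≤ Z₁ ∧ Z ≤ Z₂ := by
  obtain ⟨Z, h₁, h₂⟩ := Adm.exists_factors B (𝟙 X) Z₁ Z₂
  exact ⟨Z, h₁, Subobject.le_of_factors (by simpa using h₂)⟩

/-! ### The functor `j` -/

/-- The pro-object `j(X) = "lim" Z`, over the subobjects `Z ⊆ X` with `Z ∈ B` and `X/Z ∈ B`. -/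
def jObj (X : A) : Pro B.FullSubcategory := limit (Adm.diagram B X ⋙ Pro.of B.FullSubcategory)

/-- The projection `j(X) ⟶ Z`. -/
def jπ {X : A} (Z : Adm B X) :
    jObj B X ⟶ (Pro.of B.FullSubcategory).obj ((Adm.diagram B X).obj Z) :=
  limit.π (Adm.diagram B X ⋙ Pro.of B.FullSubcategory) Z

lemma jπ_map {X : A} {Z Z' : Adm B X} (h : Z ⟶ Z') :
    jπ B Z ≫ (Pro.of B.FullSubcategory).map ((Adm.diagram B X).map h) = jπ B Z' :=
  limit.w (Adm.diagram B X ⋙ Pro.of B.FullSubcategory) h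

lemma jObj_hom_ext {X : A} {T : Pro B.FullSubcategory} {a b : T ⟶ jObj B X}
    (h : ∀ Z, a ≫ jπ B Z = b ≫ jπ B Z) : a = b :=
  limit.hom_ext h

lemma jπ_res_eq {X X' : A} (f : X ⟶ X') (Z' : Adm B X') (Z₁ Z₂ : Adm B X)
    (h₁ : Z'.1.Factors (Z₁.1.arrow ≫ f)) (h₂ : Z'.1.Factors (Z₂.1.arrow ≫ f)) :
    jπ B Z₁ ≫ (Pro.of B.FullSubcategory).map (Adm.res B f Z₁ Z' h₁) =
      jπ B Z₂ ≫ (Pro.of B.FullSubcategory).map (Adm.res B f Z₂ Z' h₂) := by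
  obtain ⟨Z, l₁, l₂⟩ := Adm.exists_le_le B Z₁ Z₂
  rw [← jπ_map B (homOfLE l₁), ← jπ_map B (homOfLE l₂), Category.assoc, Category.assoc,
    ← Functor.map_comp, ← Functor.map_comp]
  congr 2
  apply Adm.hom_ext
  rw [ObjectProperty.FullSubcategory.comp_hom, ObjectProperty.FullSubcategory.comp_hom,
    Category.assoc, Category.assoc, Adm.res_arrow, Adm.res_arrow, ← Category.assoc,
    ← Category.assoc, Adm.diagram_map_arrow, Adm.diagram_map_arrow]

/-- The component at `Z' ⊆ X'` of `j(f) : j(X) ⟶ j(X')`: restrict `f` to any sufficiently small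
admissible `Z ⊆ X`. -/
def jMapComp {X X' : A} (f : X ⟶ X') (Z' : Adm B X') :
    jObj B X ⟶ (Pro.of B.FullSubcategory).obj ((Adm.diagram B X').obj Z') :=
  jπ B _ ≫ (Pro.of B.FullSubcategory).map (Adm.res B f _ Z'
    (Adm.exists_factors B f (Classical.arbitrary _) Z').choose_spec.2)

lemma jMapComp_eq {X X' : A} (f : X ⟶ X') (Z' : Adm B X') (Z : Adm B X)
    (h : Z'.1.Factors (Z.1.arrow ≫ f)) :
    jMapComp B f Z' = jπ B Z ≫ (Pro.of B.FullSubcategory).map (Adm.res B f Z Z' h) :=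
  jπ_res_eq B f Z' _ Z _ h

/-- The morphism `j(f) : j(X) ⟶ j(X')`. -/
def jMap {X X' : A} (f : X ⟶ X') : jObj B X ⟶ jObj B X' :=
  limit.lift (Adm.diagram B X' ⋙ Pro.of B.FullSubcategory)
    { pt := jObj B X
      π :=
        { app := fun Z' => jMapComp B f Z'
          naturality := fun Z₁ Z₂ h => by
            obtain ⟨Z, -, hZ⟩ := Adm.exists_factors B f (Classical.arbitrary _) Z₁
            have hZ₂ : Z₂.1.Factors (Z.1.arrow ≫ f) := Subobject.factors_of_le _ (leOfHom h) hZ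
            dsimp only [Functor.const_obj_obj, Functor.const_obj_map, Functor.comp_map]
            rw [jMapComp_eq B f Z₁ Z hZ, jMapComp_eq B f Z₂ Z hZ₂, Category.id_comp,
              Category.assoc, ← Functor.map_comp]
            congr 2
            apply Adm.hom_ext
            rw [ObjectProperty.FullSubcategory.comp_hom, Category.assoc,
              Adm.diagram_map_arrow, Adm.res_arrow, Adm.res_arrow] } }

/-- The characterization of `j(f)`: it is given by `f : Z ⟶ Z'` whenever `f(Z) ⊆ Z'`. -/
lemma jMap_π {X X' : A} (f : X ⟶ X') (Z' : Adm B X') (Z : Adm B X)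
    (h : Z'.1.Factors (Z.1.arrow ≫ f)) :
    jMap B f ≫ jπ B Z' = jπ B Z ≫ (Pro.of B.FullSubcategory).map (Adm.res B f Z Z' h) :=
  (limit.lift_π _ _).trans (jMapComp_eq B f Z' Z h)

/-- The functor `j : A ⥤ Pro B`. -/
def j : A ⥤ Pro B.FullSubcategory where
  obj := jObj B
  map := jMap B
  map_id X := jObj_hom_ext B fun Z => by
    have h : Z.1.Factors (Z.1.arrow ≫ 𝟙 X) := by simpa using Subobject.factors_self Z.1
    rw [jMap_π B (𝟙 X) Z Z h, Category.id_comp]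
    have : Adm.res B (𝟙 X) Z Z h = 𝟙 _ := Adm.hom_ext B (by
      rw [Adm.res_arrow, ObjectProperty.FullSubcategory.id_hom, Category.comp_id,
        Category.id_comp])
    rw [this, CategoryTheory.Functor.map_id, Category.comp_id]
  map_comp {X X' X''} f g := jObj_hom_ext B fun Z'' => by
    obtain ⟨Z', -, h'⟩ := Adm.exists_factors B g (Classical.arbitrary _) Z''
    obtain ⟨Z, -, h⟩ := Adm.exists_factors B f (Classical.arbitrary _) Z'
    have h'' : Z''.1.Factors (Z.1.arrow ≫ f ≫ g) := by
      rw [← Category.assoc, ← Subobject.factorThru_arrow _ _ h, Category.assoc]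
      exact Subobject.factors_of_factors_right _ h'
    rw [jMap_π B (f ≫ g) Z'' Z h'', Category.assoc, jMap_π B g Z'' Z' h',
      ← Category.assoc, jMap_π B f Z' Z h, Category.assoc, ← Functor.map_comp]
    congr 2
    apply Adm.hom_ext
    rw [ObjectProperty.FullSubcategory.comp_hom, Category.assoc, Adm.res_arrow, Adm.res_arrow,
      ← Category.assoc, ← Category.assoc, Adm.res_arrow]

instance j.additive : (j B).Additive where
  map_add {X X'} f g := jObj_hom_ext B fun Z' => by
    obtain ⟨W, -, hW⟩ := Adm.exists_factors B f (Classical.arbitrary _) Z'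
    obtain ⟨Z, hZ, hg⟩ := Adm.exists_factors B g W Z'
    have hf : Z'.1.Factors (Z.1.arrow ≫ f) := by
      rw [← Subobject.ofLE_arrow hZ, Category.assoc]
      exact Subobject.factors_of_factors_right _ hW
    have h : Z'.1.Factors (Z.1.arrow ≫ (f + g)) := by
      rw [Preadditive.comp_add]
      exact Subobject.factors_add _ _ hf hg
    change jMap B (f + g) ≫ _ = (jMap B f + jMap B g) ≫ _
    rw [Preadditive.add_comp, jMap_π B _ Z' Z h, jMap_π B _ Z' Z hf, jMap_π B _ Z' Z hg,
      ← Preadditive.comp_add, ← Functor.map_add]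
    congr 2
    apply Adm.hom_ext
    change _ = ((Adm.res B f Z Z' hf).hom + (Adm.res B g Z Z' hg).hom) ≫ _
    rw [Preadditive.add_comp, Adm.res_arrow, Adm.res_arrow, Adm.res_arrow,
      Preadditive.comp_add]

/-- The canonical morphism `i(j(X)) ⟶ X` of `Pro A`, where `i : Pro B ⥤ Pro A` is induced by the
inclusion: the composition `i(j(X)) ⟶ Z ⟶ X` for any admissible `Z ⊆ X`. -/
def jToId (X : A) : (Pro.map B.ι).obj (jObj B X) ⟶ (Pro.of A).obj X :=
  (Pro.map B.ι).map (jπ B (Classical.arbitrary (Adm B X))) ≫ (Pro.ofCompMap B.ι).app _ ≫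
    (Pro.of A).map (Adm.arrow B _)

lemma jToId_eq (X : A) (Z : Adm B X) :
    jToId B X = (Pro.map B.ι).map (jπ B Z) ≫ (Pro.ofCompMap B.ι).app _ ≫
      (Pro.of A).map (Adm.arrow B Z) := by
  have key : ∀ {Z₁ Z₂ : Adm B X} (h : Z₁ ≤ Z₂),
      (Pro.map B.ι).map (jπ B Z₂) ≫ (Pro.ofCompMap B.ι).app _ ≫
        (Pro.of A).map (Adm.arrow B Z₂) =
      (Pro.map B.ι).map (jπ B Z₁) ≫ (Pro.ofCompMap B.ι).app _ ≫
        (Pro.of A).map (Adm.arrow B Z₁) := fun {Z₁ Z₂} h => by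
    have n := (Pro.ofCompMap B.ι).naturality ((Adm.diagram B X).map (homOfLE h))
    simp only [Functor.comp_map] at n
    rw [← jπ_map B (homOfLE h), Functor.map_comp, Category.assoc, reassoc_of% n,
      ← Functor.map_comp, ObjectProperty.ι_map, Adm.diagram_map_arrow]
  obtain ⟨Z', h₁, h₂⟩ := Adm.exists_le_le B (Classical.arbitrary (Adm B X)) Z
  rw [key h₂, jToId, key h₁]

/-! ### The right exact functor `j̃` -/

/-- The inclusion of right exact functors `A ⥤ Pro B` into additive functors. -/
abbrev incl : (A ⥤ᵣ Pro B.FullSubcategory) ⥤ (A ⥤+ Pro B.FullSubcategory) :=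
  AdditiveFunctor.ofRightExact A (Pro B.FullSubcategory)

variable [(incl B).IsLeftAdjoint]

/-- The right exact functor `j̃ : A ⥤ Pro B`: the image of `j` under the right adjoint of the
inclusion of right exact functors into additive functors. -/
def jTilde : A ⥤ Pro B.FullSubcategory :=
  ((incl B).rightAdjoint.obj (AdditiveFunctor.of (j B))).obj

instance jTilde.preservesFiniteColimits : PreservesFiniteColimits (jTilde B) :=
  ((incl B).rightAdjoint.obj (AdditiveFunctor.of (j B))).property

instance jTilde.additive : (jTilde B).Additive :=
  ((incl B).obj ((incl B).rightAdjoint.obj (AdditiveFunctor.of (j B)))).property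

/-- The canonical morphism `j̃ ⟶ j` (the counit of the adjunction). -/
def jTildeToJ : jTilde B ⟶ j B :=
  ((Adjunction.ofIsLeftAdjoint (incl B)).counit.app (AdditiveFunctor.of (j B))).hom

/-! ### The category of quadruples -/

/-- A quadruple `(X, Y, u, v)` with `X ∈ A`, `Y ∈ B`, `u : i(Y) ⟶ X` and `v : j̃(X) ⟶ Y`,
subject to the two compatibility conditions. -/
structure Quadruple where
  X : A
  Y : B.FullSubcategory
  u : B.ι.obj Y ⟶ X
  v : (jTilde B).obj X ⟶ (Pro.of B.FullSubcategory).obj Y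
  /-- the composition `j̃(i(Y)) ⟶ j̃(X) ⟶ Y` is zero -/
  map_u_v : (jTilde B).map u ≫ v = 0
  /-- the compositions `i(j̃(X)) ⟶ i(Y) ⟶ X` and `i(j̃(X)) ⟶ i(j(X)) ⟶ X` agree -/
  square : (Pro.map B.ι).map v ≫ (Pro.ofCompMap B.ι).app Y ≫ (Pro.of A).map u =
    (Pro.map B.ι).map ((jTildeToJ B).app X) ≫ jToId B X

namespace Quadruple

variable {B}

/-- A morphism of quadruples is a pair of morphisms that commutes with `u` and with `v`. -/
@[ext]
structure Hom (S T : Quadruple B) where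
  fst : S.X ⟶ T.X
  snd : S.Y ⟶ T.Y
  comm_u : B.ι.map snd ≫ T.u = S.u ≫ fst := by cat_disch
  comm_v : (jTilde B).map fst ≫ T.v = S.v ≫ (Pro.of B.FullSubcategory).map snd := by cat_disch

instance category : Category (Quadruple B) where
  Hom := Hom
  id S :=
    { fst := 𝟙 _
      snd := 𝟙 _
      comm_u := by rw [CategoryTheory.Functor.map_id, Category.id_comp, Category.comp_id]
      comm_v := by
        rw [CategoryTheory.Functor.map_id, CategoryTheory.Functor.map_id, Category.id_comp, Category.comp_id] }
  comp f g :=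
    { fst := f.fst ≫ g.fst
      snd := f.snd ≫ g.snd
      comm_u := by
        rw [Functor.map_comp, Category.assoc, g.comm_u, ← Category.assoc, f.comm_u,
          Category.assoc]
      comm_v := by
        rw [Functor.map_comp, Functor.map_comp, Category.assoc, g.comm_v, ← Category.assoc,
          f.comm_v, Category.assoc] }
  id_comp _ := Hom.ext (Category.id_comp _) (Category.id_comp _)
  comp_id _ := Hom.ext (Category.comp_id _) (Category.comp_id _)
  assoc _ _ _ := Hom.ext (Category.assoc _ _ _) (Category.assoc _ _ _)

variable (B)

/-- The functor `π : (X, Y, u, v) ↦ X`. -/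
def π : Quadruple B ⥤ A where
  obj S := S.X
  map f := f.fst

open ZeroObject in
/-- The functor `β : Y ↦ (0, Y, 0, 0)`. -/
def β : B.FullSubcategory ⥤ Quadruple B where
  obj Y :=
    { X := 0
      Y := Y
      u := 0
      v := 0
      map_u_v := comp_zero
      square := ((Pro.of A).map_isZero (isZero_zero A)).eq_of_tgt _ _ }
  map f :=
    { fst := 𝟙 _
      snd := f
      comm_u := by rw [comp_zero, zero_comp]
      comm_v := by rw [comp_zero, zero_comp] }
  map_id _ := rfl
  map_comp _ _ := Hom.ext (Category.id_comp _).symm rfl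

end Quadruple

end

/-- The Serre quotient of an abelian category by a Serre subcategory: the localization at the
morphisms whose kernel and cokernel belong to the Serre subcategory. -/
abbrev SerreQuotient {C : Type*} [Category* C] [Abelian C] (S : ObjectProperty C)
    [S.IsSerreClass] :=
  S.isoModSerre.Localization

/-- The functor from the Serre quotient induced by a functor that inverts the morphisms whose
kernel and cokernel belong to the Serre subcategory. -/
abbrev SerreQuotient.lift {C D : Type*} [Category* C] [Abelian C] [Category* D]
    (S : ObjectProperty C) [S.IsSerreClass] (F : C ⥤ D) (hF : S.isoModSerre.IsInvertedBy F) :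
    SerreQuotient S ⥤ D :=
  Localization.Construction.lift F hF

end Devissage

end

/-!
Once `j̃` exists, the theorem uses of it only that it is right exact and comes with a natural
transformation to `j`.

*Existence of `j̃`.* Give `A` the topology whose coverings are the epimorphisms. An additive functor
`R : A ⥤ Pro C` is right exact if and only if the presheaf `X ↦ Hom(R(X), c)` is a sheaf for each
object `c` of `C` (`preservesFiniteColimits_of_isSheaf`, `isSheaf_homPresheaf`). For every `G` the
functor `c ↦ (X ↦ Hom(G(X), c))` preserves finite limits in `c`, and sheafification in the variable
`X` is left exact, so its result comes again from a functor to pro-objects. This functor is additive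
when `G` is, because its sections come locally from `G`. It is therefore the universal right exact
functor with a morphism to `G` (`isLeftAdjoint_ofRightExact`).

*The category of quadruples is abelian.* Kernels, cokernels and direct sums are computed
componentwise (`Quadruple.kernelObj`, `Quadruple.cokernelObj`, `Quadruple.biprodObj`); right
exactness of `j̃` provides `v` on the cokernel. To verify the square for the cokernel one tests an
equation between morphisms `i(T) ⟶ X` of `Pro A` after an epimorphism `T' ⟶ T` of `Pro B`. Both
sides factor through objects of `B`, hence through a common subobject of `X` in `B`, and the
extension of the inclusion to pro-objects is faithful on morphisms to constant pro-objects
(`Pro.map_injective`, `Pro.compHom_eq_of_epi`).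

*The Serre quotient.* The projection `π` is exact, and the essential image of `β` is its kernel
(`Quadruple.essImage_β`), so it is a Serre subcategory and `π` factors through the quotient; the
induced functor is faithful. It is essentially surjective: for an admissible subobject `Z ⊆ X` the
maps `j̃(X) ⟶ j(X) ⟶ Z ⟶ X` form a quadruple, because `j(Z) = 0` (`Quadruple.ofAdm`). It is full:
given quadruples with components `Y, Y'` and a morphism `f : X ⟶ X'`, let `I ⊆ X'` be the sum of the
images of `Y` and `Y'`; then `(X, Y ×_I Y')` is a quadruple which maps to both and whose
map to `(X, Y)` becomes invertible in the quotient (`Quadruple.exists_roof`).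
-/

noncomputable section

namespace Devissage

/-! ### Pro-objects -/

section

variable {C : Type u} [SmallCategory C]

/-- The morphisms from a constant ind-object to an ind-object are the sections of the
associated presheaf. -/
def indYonedaHomIso (X : C) :
    coyoneda.obj (Opposite.op (Ind.yoneda.obj X)) ≅
      Ind.inclusion C ⋙ (evaluation Cᵒᵖ (Type u)).obj (Opposite.op X) :=
  NatIso.ofComponents (fun T => Equiv.toIso
    ((Ind.inclusion.fullyFaithful.homEquiv).trans
      ((Ind.yonedaCompInclusion.app X).homFromEquiv.trans yonedaEquiv)))
    (fun {T T'} f => by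
      ext g
      simp [Functor.FullyFaithful.homEquiv, yonedaEquiv])

/-- Constant ind-objects are compact for filtered colimits. -/
instance (X : C) {J : Type u} [SmallCategory J] [IsFiltered J] :
    PreservesColimitsOfShape J (coyoneda.obj (Opposite.op (Ind.yoneda.obj X))) :=
  preservesColimitsOfShape_of_natIso (indYonedaHomIso X).symm

/-- Constant pro-objects are cocompact for cofiltered limits. -/
instance (X : C) {J : Type u} [SmallCategory J] [IsCofiltered J] :
    PreservesColimitsOfShape Jᵒᵖ (yoneda.obj ((Pro.of C).obj X)) :=
  preservesColimitsOfShape_of_natIso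
    (F := unopUnop (Ind Cᵒᵖ) ⋙ coyoneda.obj (Opposite.op (Ind.yoneda.obj (Opposite.op X))))
    (NatIso.ofComponents (fun _ => Equiv.toIso
      { toFun := fun g => Quiver.Hom.op g
        invFun := fun g => Quiver.Hom.unop g
        left_inv := fun _ => rfl
        right_inv := fun _ => rfl }) (fun _ => rfl))

instance : RepresentablyFlat (Pro.of C) := by
  have : RepresentablyFlat ((Ind.yoneda (C := Cᵒᵖ)).op) := inferInstance
  have : RepresentablyFlat (opOp C) := RepresentablyFlat.of_isRightAdjoint _
  exact inferInstanceAs (RepresentablyFlat (opOp C ⋙ (Ind.yoneda (C := Cᵒᵖ)).op))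

end

section

variable {C D : Type u} [SmallCategory C] [SmallCategory D] [Abelian D]

instance [HasFiniteLimits C] : PreservesFiniteLimits (Pro.of C) :=
  preservesFiniteLimits_rightOp _

instance [HasFiniteColimits C] : PreservesFiniteColimits (Pro.of C) :=
  have : PreservesLimits (Ind.yoneda (C := Cᵒᵖ)) := inferInstance
  have : PreservesFiniteLimits (Ind.yoneda (C := Cᵒᵖ)) := inferInstance
  preservesFiniteColimits_rightOp _

/-- The extension of `F` to pro-objects is defined by a limit over the morphisms `s : T ⟶ W` to
constant pro-objects; its projections are the images of the `s`. -/
lemma Pro.map_map_ofCompMap (F : C ⥤ D) {T : Pro C} {W : C} (s : T ⟶ (Pro.of C).obj W) :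
    (Pro.map F).map s ≫ (Pro.ofCompMap F).app W =
      limit.π (StructuredArrow.proj T (Pro.of C) ⋙ F ⋙ Pro.of D) (StructuredArrow.mk s) := by
  refine (limit.lift_π _ _).trans ?_
  change limit.π (StructuredArrow.proj T (Pro.of C) ⋙ F ⋙ Pro.of D)
    (StructuredArrow.mk (s ≫ 𝟙 _)) = _
  rw [Category.comp_id]

/-- The extension of a faithful functor to pro-objects is faithful on morphisms to constant
pro-objects: such morphisms become equal at a finite stage. -/
lemma Pro.map_injective (F : C ⥤ D) [F.Faithful] {T : Pro C} {W : C}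
    {s t : T ⟶ (Pro.of C).obj W} (h : (Pro.map F).map s = (Pro.map F).map t) : s = t := by
  have h' : limit.π (StructuredArrow.proj T (Pro.of C) ⋙ F ⋙ Pro.of D) (StructuredArrow.mk s) ≫
        𝟙 ((Pro.of D).obj (F.obj W)) =
      limit.π (StructuredArrow.proj T (Pro.of C) ⋙ F ⋙ Pro.of D) (StructuredArrow.mk t) ≫
        𝟙 ((Pro.of D).obj (F.obj W)) := by
    congr 1
    rw [← Pro.map_map_ofCompMap, ← Pro.map_map_ofCompMap, h]
  obtain ⟨k, a, b, hab⟩ := exists_eq_of_preservesColimit_yoneda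
    (D := StructuredArrow.proj T (Pro.of C) ⋙ F ⋙ Pro.of D) (limit.isLimit _)
    (X := (Pro.of D).obj (F.obj W)) (i := StructuredArrow.mk s) (j := StructuredArrow.mk t)
    (𝟙 _) (𝟙 _) h'
  have hab' : a.right = b.right := by
    have h₁ := (Category.comp_id _).symm.trans (hab.trans (Category.comp_id _))
    exact F.map_injective ((Pro.of D).map_injective h₁)
  have ha := StructuredArrow.w a
  have hb := StructuredArrow.w b
  rw [hab'] at ha
  exact ha.symm.trans hb

end

/-! ### The canonical morphisms from `j(X)` and `j̃(X)` to `X` -/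

section

variable {A : Type u} [SmallCategory A] [Abelian A] {B : ObjectProperty A}

/-- The morphism `i(T) ⟶ i(Y) ⟶ X` of `Pro A` determined by `a : T ⟶ Y` in `Pro B` and
`u : i(Y) ⟶ X` in `A`. -/
def Pro.compHom {T : Pro B.FullSubcategory} {Y : B.FullSubcategory} {X : A}
    (a : T ⟶ (Pro.of B.FullSubcategory).obj Y) (u : B.ι.obj Y ⟶ X) :
    (Pro.map B.ι).obj T ⟶ (Pro.of A).obj X :=
  (Pro.map B.ι).map a ≫ (Pro.ofCompMap B.ι).app Y ≫ (Pro.of A).map u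

lemma Pro.map_compHom {T T' : Pro B.FullSubcategory} {Y : B.FullSubcategory} {X : A}
    (p : T' ⟶ T) (a : T ⟶ (Pro.of B.FullSubcategory).obj Y) (u : B.ι.obj Y ⟶ X) :
    (Pro.map B.ι).map p ≫ Pro.compHom a u = Pro.compHom (p ≫ a) u := by
  rw [Pro.compHom, Pro.compHom, Functor.map_comp, Category.assoc]

lemma Pro.compHom_map {T : Pro B.FullSubcategory} {Y : B.FullSubcategory} {X X' : A}
    (a : T ⟶ (Pro.of B.FullSubcategory).obj Y) (u : B.ι.obj Y ⟶ X) (f : X ⟶ X') :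
    Pro.compHom a u ≫ (Pro.of A).map f = Pro.compHom a (u ≫ f) := by
  rw [Pro.compHom, Pro.compHom, Category.assoc, Category.assoc, ← Functor.map_comp]

lemma Pro.compHom_of_map {T : Pro B.FullSubcategory} {Y Y' : B.FullSubcategory} {X : A}
    (a : T ⟶ (Pro.of B.FullSubcategory).obj Y) (k : Y ⟶ Y') (u : B.ι.obj Y' ⟶ X) :
    Pro.compHom (a ≫ (Pro.of B.FullSubcategory).map k) u = Pro.compHom a (B.ι.map k ≫ u) := by
  have n := (Pro.ofCompMap B.ι).naturality k
  simp only [Functor.comp_map] at n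
  rw [Pro.compHom, Pro.compHom, Functor.map_comp, Functor.map_comp, Category.assoc,
    reassoc_of% n]

/-- The morphism `i(T) ⟶ i(Y) ⟶ X` determines `T ⟶ Y` when `i(Y) ⟶ X` is a monomorphism. -/
lemma Pro.compHom_injective {T : Pro B.FullSubcategory} {Y : B.FullSubcategory} {X : A}
    {a b : T ⟶ (Pro.of B.FullSubcategory).obj Y} (u : B.ι.obj Y ⟶ X) [Mono u]
    (h : Pro.compHom a u = Pro.compHom b u) : a = b := by
  apply Pro.map_injective B.ι
  rwa [Pro.compHom, Pro.compHom, ← Category.assoc, ← Category.assoc, cancel_mono,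
    cancel_mono] at h

end

section

variable {A : Type u} [SmallCategory A] [Abelian A] (B : ObjectProperty A)
  [IsTwoStepSubcategory B]

/-- Two morphisms to `X` from objects of `B` factor through a common subobject of `X` in `B`, namely
the image of their sum: `B` is closed under finite sums and quotients. -/
lemma exists_common_subobject {X : A} {Y Z : B.FullSubcategory} (u : B.ι.obj Y ⟶ X)
    (m : B.ι.obj Z ⟶ X) :
    ∃ (I : B.FullSubcategory) (k : Y ⟶ I) (l : Z ⟶ I) (e : B.ι.obj I ⟶ X),
      Mono e ∧ B.ι.map k ≫ e = u ∧ B.ι.map l ≫ e = m := by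
  let d : B.ι.obj Y ⊞ B.ι.obj Z ⟶ X := biprod.desc u m
  have hI : B (Abelian.image d) := B.prop_of_epi (Abelian.factorThruImage d)
    (B.prop_of_iso (biprod.isoProd _ _).symm (B.prop_prod _ _ Y.2 Z.2))
  refine ⟨⟨_, hI⟩, B.homMk (biprod.inl ≫ Abelian.factorThruImage d),
    B.homMk (biprod.inr ≫ Abelian.factorThruImage d), Abelian.image.ι d, inferInstance, ?_, ?_⟩
  · simp [d]
  · simp [d]

/-- Equations between morphisms `i(T) ⟶ X` that factor through objects of `B` can be tested after
an epimorphism `T' ⟶ T`. This replaces the exactness of `Pro B ⥤ Pro A`: both morphisms factor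
through the same subobject of `X` in `B`, so the equation holds already in `Pro B`. -/
lemma Pro.compHom_eq_of_epi {T T' : Pro B.FullSubcategory} {Y Z : B.FullSubcategory} {X : A}
    (p : T' ⟶ T) [Epi p]
    (a : T ⟶ (Pro.of B.FullSubcategory).obj Y) (u : B.ι.obj Y ⟶ X)
    (b : T ⟶ (Pro.of B.FullSubcategory).obj Z) (m : B.ι.obj Z ⟶ X)
    (h : (Pro.map B.ι).map p ≫ Pro.compHom a u = (Pro.map B.ι).map p ≫ Pro.compHom b m) :
    Pro.compHom a u = Pro.compHom b m := by
  obtain ⟨I, k, l, e, he, rfl, rfl⟩ := exists_common_subobject B u m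
  rw [← Pro.compHom_of_map, ← Pro.compHom_of_map] at h ⊢
  rw [Pro.map_compHom, Pro.map_compHom] at h
  rw [(cancel_epi p).1 (Pro.compHom_injective e h)]

/-- The projection `j(X) ⟶ Z` to an admissible subobject `Z ⊆ X`. -/
def jProj {X : A} (Z : Adm B X) :
    (j B).obj X ⟶ (Pro.of B.FullSubcategory).obj ((Adm.diagram B X).obj Z) :=
  jπ B Z

lemma j_map_jProj {X X' : A} (f : X ⟶ X') (Z' : Adm B X') (Z : Adm B X)
    (h : Z'.1.Factors (Z.1.arrow ≫ f)) :
    (j B).map f ≫ jProj B Z' =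
      jProj B Z ≫ (Pro.of B.FullSubcategory).map (Adm.res B f Z Z' h) :=
  jMap_π B f Z' Z h

/-- The canonical morphism `i(j(X)) ⟶ X`, that is `jToId` with source written as the value of the
functor `j`. -/
def jCan (X : A) : (Pro.map B.ι).obj ((j B).obj X) ⟶ (Pro.of A).obj X := jToId B X

lemma jCan_eq_compHom (X : A) (Z : Adm B X) :
    jCan B X = Pro.compHom (jProj B Z) (Adm.arrow B Z) :=
  jToId_eq B X Z

lemma jCan_naturality {X X' : A} (f : X ⟶ X') :
    (Pro.map B.ι).map ((j B).map f) ≫ jCan B X' = jCan B X ≫ (Pro.of A).map f := by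
  let Z' : Adm B X' := Classical.arbitrary _
  obtain ⟨Z, -, hZ⟩ := Adm.exists_factors B f (Classical.arbitrary _) Z'
  rw [jCan_eq_compHom B X' Z', jCan_eq_compHom B X Z, Pro.map_compHom, j_map_jProj B f Z' Z hZ,
    Pro.compHom_of_map, Pro.compHom_map, ObjectProperty.ι_map, Adm.res_arrow]

/-- For `Y` in `B` the zero subobject is admissible, so `j(Y) = 0`. -/
lemma isZero_j_obj (Y : B.FullSubcategory) : IsZero ((j B).obj (B.ι.obj Y)) := by
  let Z : Adm B (B.ι.obj Y) :=
    ⟨⊥, B.prop_of_isZero (IsZero.of_iso (isZero_zero _) Subobject.botCoeIsoZero),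
      B.prop_of_epi (cokernel.π _) Y.2⟩
  have hZ : IsZero ((Adm.diagram B _).obj Z) := by
    rw [IsZero.iff_id_eq_zero]
    apply B.ι.map_injective
    exact (IsZero.of_iso (isZero_zero _) Subobject.botCoeIsoZero).eq_of_src _ _
  have h0 (T : Pro B.FullSubcategory) (a b : T ⟶ jObj B (B.ι.obj Y)) : a = b := by
    apply jObj_hom_ext
    intro Z'
    rw [← jπ_map B (homOfLE (show Z ≤ Z' from bot_le (a := Z'.1))), ← Category.assoc,
      ← Category.assoc]
    congr 1
    exact ((Pro.of _).map_isZero hZ).eq_of_tgt _ _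
  rw [IsZero.iff_id_eq_zero]
  exact h0 _ _ _

variable [(incl B).IsLeftAdjoint]

/-- The canonical morphism `i(j̃(X)) ⟶ i(j(X)) ⟶ X`. -/
def jTildeCan (X : A) : (Pro.map B.ι).obj ((jTilde B).obj X) ⟶ (Pro.of A).obj X :=
  (Pro.map B.ι).map ((jTildeToJ B).app X) ≫ jCan B X

lemma jTildeCan_naturality {X X' : A} (f : X ⟶ X') :
    (Pro.map B.ι).map ((jTilde B).map f) ≫ jTildeCan B X' =
      jTildeCan B X ≫ (Pro.of A).map f := by
  rw [jTildeCan, jTildeCan, Category.assoc, ← jCan_naturality, ← Functor.map_comp_assoc,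
    ← Functor.map_comp_assoc, (jTildeToJ B).naturality]

lemma jTildeCan_eq_compHom (X : A) (Z : Adm B X) :
    jTildeCan B X = Pro.compHom ((jTildeToJ B).app X ≫ jProj B Z) (Adm.arrow B Z) := by
  rw [← Pro.map_compHom, ← jCan_eq_compHom]
  rfl

end

/-! ### Quadruples form an abelian category -/

section

variable {C D : Type*} [Category* C] [Category* D] [HasZeroMorphisms C] [HasZeroMorphisms D]
  (F : C ⥤ D) [F.PreservesZeroMorphisms] {X Y : C} (g : X ⟶ Y)

/-- The factorization through `F (kernel g)` of a morphism killed by `F g`. -/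
def mapKernelLift [HasKernel g] [PreservesLimit (parallelPair g 0) F] {T : D}
    (t : T ⟶ F.obj X) (h : t ≫ F.map g = 0) : T ⟶ F.obj (kernel g) :=
  (KernelFork.mapIsLimit _ (kernelIsKernel g) F).lift (KernelFork.ofι t h)

lemma mapKernelLift_ι [HasKernel g] [PreservesLimit (parallelPair g 0) F] {T : D}
    (t : T ⟶ F.obj X) (h : t ≫ F.map g = 0) :
    mapKernelLift F g t h ≫ F.map (kernel.ι g) = t :=
  (KernelFork.mapIsLimit _ (kernelIsKernel g) F).fac (KernelFork.ofι t h)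
    WalkingParallelPair.zero

/-- The factorization through `F (cokernel g)` of a morphism that kills `F g`. -/
def mapCokernelDesc [HasCokernel g] [PreservesColimit (parallelPair g 0) F] {T : D}
    (t : F.obj Y ⟶ T) (h : F.map g ≫ t = 0) : F.obj (cokernel g) ⟶ T :=
  (CokernelCofork.mapIsColimit _ (cokernelIsCokernel g) F).desc (CokernelCofork.ofπ t h)

lemma map_π_mapCokernelDesc [HasCokernel g] [PreservesColimit (parallelPair g 0) F] {T : D}
    (t : F.obj Y ⟶ T) (h : F.map g ≫ t = 0) :
    F.map (cokernel.π g) ≫ mapCokernelDesc F g t h = t :=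
  (CokernelCofork.mapIsColimit _ (cokernelIsCokernel g) F).fac (CokernelCofork.ofπ t h)
    WalkingParallelPair.one

end

section

variable {A : Type u} [SmallCategory A] [Abelian A] {B : ObjectProperty A}
  [IsTwoStepSubcategory B] [(incl B).IsLeftAdjoint]

instance {X Y : B.FullSubcategory} (g : X ⟶ Y) :
    PreservesColimit (parallelPair g 0) B.ι :=
  B.preservesCokernels_ι g

instance : B.ι.PreservesEpimorphisms := B.preservesEpimorphisms_ι_of_isNormalMonoCategory

namespace Quadruple

lemma compHom_v_u (S : Quadruple B) : Pro.compHom S.v S.u = jTildeCan B S.X := S.square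

variable {S T : Quadruple B}

lemma hom_ext {f g : S ⟶ T} (h₁ : f.fst = g.fst) (h₂ : f.snd = g.snd) : f = g :=
  Hom.ext h₁ h₂

@[simp]
lemma id_fst (S : Quadruple B) : Hom.fst (𝟙 S) = 𝟙 S.X := rfl

@[simp]
lemma id_snd (S : Quadruple B) : Hom.snd (𝟙 S) = 𝟙 S.Y := rfl

@[simp]
lemma comp_fst {S T U : Quadruple B} (f : S ⟶ T) (g : T ⟶ U) :
    (f ≫ g).fst = f.fst ≫ g.fst := rfl

@[simp]
lemma comp_snd {S T U : Quadruple B} (f : S ⟶ T) (g : T ⟶ U) :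
    (f ≫ g).snd = f.snd ≫ g.snd := rfl

instance : Zero (S ⟶ T) := ⟨Hom.mk 0 0 (by simp) (by simp)⟩

instance : Add (S ⟶ T) := ⟨fun f g => Hom.mk (f.fst + g.fst) (f.snd + g.snd)
  (by rw [Functor.map_add, Preadditive.add_comp, Preadditive.comp_add, f.comm_u, g.comm_u])
  (by rw [Functor.map_add, Functor.map_add, Preadditive.add_comp, Preadditive.comp_add,
    f.comm_v, g.comm_v])⟩

instance : Neg (S ⟶ T) := ⟨fun f => Hom.mk (-f.fst) (-f.snd)
  (by rw [Functor.map_neg, Preadditive.neg_comp, Preadditive.comp_neg, f.comm_u])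
  (by rw [Functor.map_neg, Functor.map_neg, Preadditive.neg_comp, Preadditive.comp_neg,
    f.comm_v])⟩

instance : AddCommGroup (S ⟶ T) where
  add_assoc f g h := hom_ext (add_assoc _ _ _) (add_assoc _ _ _)
  zero_add f := hom_ext (zero_add _) (zero_add _)
  add_zero f := hom_ext (add_zero _) (add_zero _)
  add_comm f g := hom_ext (add_comm _ _) (add_comm _ _)
  neg_add_cancel f := hom_ext (neg_add_cancel _) (neg_add_cancel _)
  nsmul := nsmulRec
  zsmul := zsmulRec

instance : Preadditive (Quadruple B) where
  add_comp _ _ _ _ _ _ := hom_ext (Preadditive.add_comp ..) (Preadditive.add_comp ..)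
  comp_add _ _ _ _ _ _ := hom_ext (Preadditive.comp_add ..) (Preadditive.comp_add ..)

variable (B) in
/-- The functor `(X, Y, u, v) ↦ Y`. -/
def ρ : Quadruple B ⥤ B.FullSubcategory where
  obj S := S.Y
  map f := f.snd

instance : (π B).Additive where
instance : (ρ B).Additive where

lemma isIso_of_isIso (f : S ⟶ T) [IsIso f.fst] [IsIso f.snd] : IsIso f := by
  refine ⟨Hom.mk (inv f.fst) (inv f.snd) ?_ ?_, hom_ext (by simp) (by simp),
    hom_ext (by simp) (by simp)⟩
  · rw [← cancel_epi (B.ι.map f.snd), ← Functor.map_comp_assoc, IsIso.hom_inv_id,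
      ← Category.assoc, f.comm_u]
    simp
  · rw [← cancel_epi ((jTilde B).map f.fst), ← Functor.map_comp_assoc, IsIso.hom_inv_id,
      ← Category.assoc, f.comm_v, Category.assoc, ← Functor.map_comp, IsIso.hom_inv_id]
    simp

lemma isZero_of_isZero (S : Quadruple B) (h₁ : IsZero S.X) (h₂ : IsZero S.Y) : IsZero S := by
  rw [IsZero.iff_id_eq_zero]
  exact hom_ext (h₁.eq_of_src _ _) (h₂.eq_of_src _ _)

/-- The morphism `u` of the kernel of a morphism of quadruples. -/
def kernelU (f : S ⟶ T) : B.ι.obj (kernel f.snd) ⟶ kernel f.fst :=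
  kernel.lift _ (B.ι.map (kernel.ι f.snd) ≫ S.u) (by
    rw [Category.assoc, ← f.comm_u, ← Functor.map_comp_assoc, kernel.condition,
      Functor.map_zero, zero_comp])

/-- The morphism `v` of the kernel of a morphism of quadruples. -/
def kernelV (f : S ⟶ T) :
    (jTilde B).obj (kernel f.fst) ⟶ (Pro.of B.FullSubcategory).obj (kernel f.snd) :=
  mapKernelLift (Pro.of B.FullSubcategory) f.snd ((jTilde B).map (kernel.ι f.fst) ≫ S.v) (by
    rw [Category.assoc, ← f.comm_v, ← Functor.map_comp_assoc, kernel.condition,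
      Functor.map_zero, zero_comp])

lemma kernelU_ι (f : S ⟶ T) : kernelU f ≫ kernel.ι f.fst = B.ι.map (kernel.ι f.snd) ≫ S.u :=
  kernel.lift_ι _ _ _

lemma kernelV_ι (f : S ⟶ T) : kernelV f ≫ (Pro.of B.FullSubcategory).map (kernel.ι f.snd) =
    (jTilde B).map (kernel.ι f.fst) ≫ S.v :=
  mapKernelLift_ι _ _ _ _

/-- The kernel of a morphism of quadruples, computed componentwise. -/
def kernelObj (f : S ⟶ T) : Quadruple B where
  X := kernel f.fst
  Y := kernel f.snd
  u := kernelU f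
  v := kernelV f
  map_u_v := by
    rw [← cancel_mono ((Pro.of B.FullSubcategory).map (kernel.ι f.snd)), Category.assoc,
      kernelV_ι, ← Functor.map_comp_assoc, kernelU_ι, Functor.map_comp,
      Category.assoc, S.map_u_v, comp_zero, zero_comp]
  square := by
    change Pro.compHom _ _ = jTildeCan B _
    rw [← cancel_mono ((Pro.of A).map (kernel.ι f.fst)), Pro.compHom_map, kernelU_ι,
      ← Pro.compHom_of_map, kernelV_ι, ← Pro.map_compHom, compHom_v_u,
      jTildeCan_naturality]

/-- The inclusion of the kernel of a morphism of quadruples. -/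
def kernelι (f : S ⟶ T) : kernelObj f ⟶ S :=
  Hom.mk (kernel.ι f.fst) (kernel.ι f.snd) (kernelU_ι f).symm (kernelV_ι f).symm

/-- The componentwise kernel is a kernel. -/
def isLimitKernel (f : S ⟶ T) : IsLimit (KernelFork.ofι (f := f) (kernelι f)
    (hom_ext (kernel.condition _) (kernel.condition _))) :=
  KernelFork.IsLimit.ofι _ _
    (fun {W} k hk =>
      have h₁ : k.fst ≫ f.fst = 0 := congrArg Hom.fst hk
      have h₂ : k.snd ≫ f.snd = 0 := congrArg Hom.snd hk
      Hom.mk (kernel.lift _ k.fst h₁) (kernel.lift _ k.snd h₂)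
        (by
          change B.ι.map (kernel.lift _ k.snd h₂) ≫ kernelU f = W.u ≫ kernel.lift _ k.fst h₁
          rw [← cancel_mono (kernel.ι f.fst), Category.assoc, Category.assoc, kernel.lift_ι,
            ← k.comm_u, kernelU_ι, ← Functor.map_comp_assoc, kernel.lift_ι])
        (by
          change (jTilde B).map (kernel.lift _ k.fst h₁) ≫ kernelV f =
            W.v ≫ (Pro.of B.FullSubcategory).map (kernel.lift _ k.snd h₂)
          rw [← cancel_mono ((Pro.of B.FullSubcategory).map (kernel.ι f.snd)), Category.assoc,
            Category.assoc, ← Functor.map_comp, kernel.lift_ι, ← k.comm_v, kernelV_ι,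
            ← Functor.map_comp_assoc, kernel.lift_ι]))
    (fun k hk => hom_ext (kernel.lift_ι _ _ _) (kernel.lift_ι _ _ _))
    (fun k hk m hm => hom_ext
      ((cancel_mono (kernel.ι f.fst)).1
        ((congrArg Hom.fst hm).trans (kernel.lift_ι f.fst _ _).symm))
      ((cancel_mono (kernel.ι f.snd)).1
        ((congrArg Hom.snd hm).trans (kernel.lift_ι f.snd _ _).symm)))

/-- The morphism `u` of the cokernel of a morphism of quadruples. -/
def cokernelU (f : S ⟶ T) : B.ι.obj (cokernel f.snd) ⟶ cokernel f.fst :=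
  mapCokernelDesc B.ι f.snd (T.u ≫ cokernel.π f.fst) (by
    rw [← Category.assoc, f.comm_u, Category.assoc, cokernel.condition, comp_zero])

/-- The morphism `v` of the cokernel of a morphism of quadruples. -/
def cokernelV (f : S ⟶ T) :
    (jTilde B).obj (cokernel f.fst) ⟶ (Pro.of B.FullSubcategory).obj (cokernel f.snd) :=
  mapCokernelDesc (jTilde B) f.fst
    (T.v ≫ (Pro.of B.FullSubcategory).map (cokernel.π f.snd)) (by
      rw [← Category.assoc, f.comm_v, Category.assoc, ← Functor.map_comp, cokernel.condition,
        Functor.map_zero, comp_zero])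

lemma map_π_cokernelU (f : S ⟶ T) :
    B.ι.map (cokernel.π f.snd) ≫ cokernelU f = T.u ≫ cokernel.π f.fst :=
  map_π_mapCokernelDesc _ _ _ _

lemma map_π_cokernelV (f : S ⟶ T) : (jTilde B).map (cokernel.π f.fst) ≫ cokernelV f =
    T.v ≫ (Pro.of B.FullSubcategory).map (cokernel.π f.snd) :=
  map_π_mapCokernelDesc _ _ _ _

/-- The cokernel of a morphism of quadruples, computed componentwise, since `j̃` is right
exact. -/
def cokernelObj (f : S ⟶ T) : Quadruple B where
  X := cokernel f.fst
  Y := cokernel f.snd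
  u := cokernelU f
  v := cokernelV f
  map_u_v := by
    rw [← cancel_epi ((jTilde B).map (B.ι.map (cokernel.π f.snd))), ← Functor.map_comp_assoc,
      map_π_cokernelU, Functor.map_comp, Category.assoc, map_π_cokernelV,
      ← Category.assoc, T.map_u_v, comp_zero, zero_comp]
  square := by
    change Pro.compHom _ _ = jTildeCan B _
    rw [jTildeCan_eq_compHom B _ (Classical.arbitrary _)]
    apply Pro.compHom_eq_of_epi B ((jTilde B).map (cokernel.π f.fst))
    rw [← jTildeCan_eq_compHom, jTildeCan_naturality, Pro.map_compHom, map_π_cokernelV,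
      Pro.compHom_of_map, map_π_cokernelU, ← Pro.compHom_map, compHom_v_u]

/-- The projection to the cokernel of a morphism of quadruples. -/
def cokernelπ (f : S ⟶ T) : T ⟶ cokernelObj f :=
  Hom.mk (cokernel.π f.fst) (cokernel.π f.snd) (map_π_cokernelU f) (map_π_cokernelV f)

/-- The componentwise cokernel is a cokernel. -/
def isColimitCokernel (f : S ⟶ T) : IsColimit (CokernelCofork.ofπ (f := f) (cokernelπ f)
    (hom_ext (cokernel.condition _) (cokernel.condition _))) :=
  CokernelCofork.IsColimit.ofπ _ _
    (fun {W} k hk =>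
      have h₁ : f.fst ≫ k.fst = 0 := congrArg Hom.fst hk
      have h₂ : f.snd ≫ k.snd = 0 := congrArg Hom.snd hk
      Hom.mk (cokernel.desc _ k.fst h₁) (cokernel.desc _ k.snd h₂)
        (by
          change B.ι.map (cokernel.desc _ k.snd h₂) ≫ W.u =
            cokernelU f ≫ cokernel.desc _ k.fst h₁
          rw [← cancel_epi (B.ι.map (cokernel.π f.snd)), ← Functor.map_comp_assoc,
            cokernel.π_desc, k.comm_u, ← Category.assoc, map_π_cokernelU, Category.assoc,
            cokernel.π_desc])
        (by
          change (jTilde B).map (cokernel.desc _ k.fst h₁) ≫ W.v =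
            cokernelV f ≫ (Pro.of B.FullSubcategory).map (cokernel.desc _ k.snd h₂)
          rw [← cancel_epi ((jTilde B).map (cokernel.π f.fst)), ← Functor.map_comp_assoc,
            cokernel.π_desc, k.comm_v, ← Category.assoc, map_π_cokernelV, Category.assoc,
            ← Functor.map_comp, cokernel.π_desc]))
    (fun k hk => hom_ext (cokernel.π_desc _ _ _) (cokernel.π_desc _ _ _))
    (fun k hk m hm => hom_ext
      ((cancel_epi (cokernel.π f.fst)).1
        ((congrArg Hom.fst hm).trans (cokernel.π_desc f.fst _ _).symm))
      ((cancel_epi (cokernel.π f.snd)).1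
        ((congrArg Hom.snd hm).trans (cokernel.π_desc f.snd _ _).symm)))

instance : HasKernels (Quadruple B) := ⟨fun f => ⟨_, isLimitKernel f⟩⟩

instance : HasCokernels (Quadruple B) := ⟨fun f => ⟨_, isColimitCokernel f⟩⟩

instance (f : S ⟶ T) : PreservesLimit (parallelPair f 0) (π B) :=
  preservesLimit_of_preserves_limit_cone (isLimitKernel f)
    ((KernelFork.isLimitMapConeEquiv _ _).symm (kernelIsKernel f.fst))

instance (f : S ⟶ T) : PreservesLimit (parallelPair f 0) (ρ B) :=
  preservesLimit_of_preserves_limit_cone (isLimitKernel f)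
    ((KernelFork.isLimitMapConeEquiv _ _).symm (kernelIsKernel f.snd))

instance (f : S ⟶ T) : PreservesColimit (parallelPair f 0) (π B) :=
  preservesColimit_of_preserves_colimit_cocone (isColimitCokernel f)
    ((CokernelCofork.isColimitMapCoconeEquiv _ _).symm (cokernelIsCokernel f.fst))

instance (f : S ⟶ T) : PreservesColimit (parallelPair f 0) (ρ B) :=
  preservesColimit_of_preserves_colimit_cocone (isColimitCokernel f)
    ((CokernelCofork.isColimitMapCoconeEquiv _ _).symm (cokernelIsCokernel f.snd))

/-- The constant pro-object on `X ⊞ Y` is a product of those on `X` and `Y`. -/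
lemma of_biprod_hom_ext {C : Type u} [SmallCategory C] [Abelian C] {T : Pro C} {X Y : C}
    {a b : T ⟶ (Pro.of C).obj (X ⊞ Y)}
    (h₁ : a ≫ (Pro.of C).map biprod.fst = b ≫ (Pro.of C).map biprod.fst)
    (h₂ : a ≫ (Pro.of C).map biprod.snd = b ≫ (Pro.of C).map biprod.snd) : a = b := by
  have key (c : T ⟶ (Pro.of C).obj (X ⊞ Y)) :
      c = (c ≫ (Pro.of C).map biprod.fst) ≫ (Pro.of C).map biprod.inl +
        (c ≫ (Pro.of C).map biprod.snd) ≫ (Pro.of C).map biprod.inr := by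
    rw [Category.assoc, Category.assoc, ← Functor.map_comp, ← Functor.map_comp,
      ← Preadditive.comp_add, ← Functor.map_add, biprod.total, CategoryTheory.Functor.map_id,
      Category.comp_id]
  rw [key a, key b, h₁, h₂]

/-- The morphism `v` of the direct sum of two quadruples. -/
def biprodV (S T : Quadruple B) :
    (jTilde B).obj (S.X ⊞ T.X) ⟶ (Pro.of B.FullSubcategory).obj (S.Y ⊞ T.Y) :=
  (jTilde B).map biprod.fst ≫ S.v ≫ (Pro.of B.FullSubcategory).map biprod.inl +
    (jTilde B).map biprod.snd ≫ T.v ≫ (Pro.of B.FullSubcategory).map biprod.inr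

lemma biprodV_fst (S T : Quadruple B) :
    biprodV S T ≫ (Pro.of B.FullSubcategory).map biprod.fst =
      (jTilde B).map biprod.fst ≫ S.v := by
  rw [biprodV, Preadditive.add_comp, Category.assoc, Category.assoc, Category.assoc,
    Category.assoc, ← Functor.map_comp, ← Functor.map_comp, biprod.inl_fst, biprod.inr_fst,
    CategoryTheory.Functor.map_id, Functor.map_zero, comp_zero, comp_zero, add_zero,
    Category.comp_id]

lemma biprodV_snd (S T : Quadruple B) :
    biprodV S T ≫ (Pro.of B.FullSubcategory).map biprod.snd =
      (jTilde B).map biprod.snd ≫ T.v := by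
  rw [biprodV, Preadditive.add_comp, Category.assoc, Category.assoc, Category.assoc,
    Category.assoc, ← Functor.map_comp, ← Functor.map_comp, biprod.inl_snd, biprod.inr_snd,
    CategoryTheory.Functor.map_id, Functor.map_zero, comp_zero, comp_zero, zero_add,
    Category.comp_id]

/-- The direct sum of two quadruples. -/
def biprodObj (S T : Quadruple B) : Quadruple B where
  X := S.X ⊞ T.X
  Y := S.Y ⊞ T.Y
  u := biprod.lift (B.ι.map biprod.fst ≫ S.u) (B.ι.map biprod.snd ≫ T.u)
  v := biprodV S T
  map_u_v := by
    apply of_biprod_hom_ext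
    · rw [Category.assoc, biprodV_fst, ← Functor.map_comp_assoc, biprod.lift_fst,
        Functor.map_comp, Category.assoc, S.map_u_v, comp_zero, zero_comp]
    · rw [Category.assoc, biprodV_snd, ← Functor.map_comp_assoc, biprod.lift_snd,
        Functor.map_comp, Category.assoc, T.map_u_v, comp_zero, zero_comp]
  square := by
    change Pro.compHom _ _ = jTildeCan B _
    apply of_biprod_hom_ext
    · rw [Pro.compHom_map, biprod.lift_fst, ← Pro.compHom_of_map, ← jTildeCan_naturality,
        ← compHom_v_u, Pro.map_compHom, biprodV_fst]
    · rw [Pro.compHom_map, biprod.lift_snd, ← Pro.compHom_of_map, ← jTildeCan_naturality,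
        ← compHom_v_u, Pro.map_compHom, biprodV_snd]

/-- The direct sum of two quadruples with its projections. -/
def binaryFan (S T : Quadruple B) : BinaryFan S T :=
  BinaryFan.mk (P := biprodObj S T)
    (Hom.mk biprod.fst biprod.fst (biprod.lift_fst _ _).symm (biprodV_fst S T).symm)
    (Hom.mk biprod.snd biprod.snd (biprod.lift_snd _ _).symm (biprodV_snd S T).symm)

/-- The morphism to a direct sum of quadruples with given components. -/
def biprodLift {W : Quadruple B} (p : W ⟶ S) (q : W ⟶ T) : W ⟶ biprodObj S T :=
  Hom.mk (biprod.lift p.fst q.fst) (biprod.lift p.snd q.snd)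
    (by
      change B.ι.map (biprod.lift p.snd q.snd) ≫
        biprod.lift (B.ι.map biprod.fst ≫ S.u) (B.ι.map biprod.snd ≫ T.u) =
          W.u ≫ biprod.lift p.fst q.fst
      apply biprod.hom_ext
      · rw [Category.assoc, Category.assoc, biprod.lift_fst, biprod.lift_fst,
          ← Functor.map_comp_assoc, biprod.lift_fst, p.comm_u]
      · rw [Category.assoc, Category.assoc, biprod.lift_snd, biprod.lift_snd,
          ← Functor.map_comp_assoc, biprod.lift_snd, q.comm_u])
    (by
      change (jTilde B).map (biprod.lift p.fst q.fst) ≫ biprodV S T =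
          W.v ≫ (Pro.of B.FullSubcategory).map (biprod.lift p.snd q.snd)
      apply of_biprod_hom_ext
      · rw [Category.assoc, Category.assoc, biprodV_fst, ← Functor.map_comp_assoc,
          ← Functor.map_comp, biprod.lift_fst, biprod.lift_fst, p.comm_v]
      · rw [Category.assoc, Category.assoc, biprodV_snd, ← Functor.map_comp_assoc,
          ← Functor.map_comp, biprod.lift_snd, biprod.lift_snd, q.comm_v])

/-- The direct sum of two quadruples is a product. -/
def isLimitBinaryFan (S T : Quadruple B) : IsLimit (binaryFan S T) :=
  BinaryFan.isLimitMk (fun s => biprodLift s.fst s.snd)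
    (fun _ => hom_ext (biprod.lift_fst _ _) (biprod.lift_fst _ _))
    (fun _ => hom_ext (biprod.lift_snd _ _) (biprod.lift_snd _ _))
    (fun _ _ h₁ h₂ => hom_ext
      (biprod.hom_ext _ _
        ((congrArg Hom.fst h₁).trans (biprod.lift_fst _ _).symm)
        ((congrArg Hom.fst h₂).trans (biprod.lift_snd _ _).symm))
      (biprod.hom_ext _ _
        ((congrArg Hom.snd h₁).trans (biprod.lift_fst _ _).symm)
        ((congrArg Hom.snd h₂).trans (biprod.lift_snd _ _).symm)))

open ZeroObject in
lemma isZero_β_zero : IsZero ((β B).obj 0) :=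
  isZero_of_isZero _ (isZero_zero _) (isZero_zero _)

instance : HasZeroObject (Quadruple B) := ⟨_, isZero_β_zero⟩

instance : HasFiniteProducts (Quadruple B) :=
  have (S T : Quadruple B) : HasLimit (pair S T) := ⟨_, isLimitBinaryFan S T⟩
  have : HasBinaryProducts (Quadruple B) := hasBinaryProducts_of_hasLimit_pair _
  hasFiniteProducts_of_has_binary_and_terminal

instance (f : S ⟶ T) : IsIso (Abelian.coimageImageComparison f) := by
  have h₁ : IsIso ((π B).map (Abelian.coimageImageComparison f)) :=
    (Arrow.isIso_iff_isIso_of_isIso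
      (Abelian.PreservesCoimageImageComparison.iso (π B) f).hom).2 inferInstance
  have h₂ : IsIso ((ρ B).map (Abelian.coimageImageComparison f)) :=
    (Arrow.isIso_iff_isIso_of_isIso
      (Abelian.PreservesCoimageImageComparison.iso (ρ B) f).hom).2 inferInstance
  have : IsIso (Hom.fst (Abelian.coimageImageComparison f)) := h₁
  have : IsIso (Hom.snd (Abelian.coimageImageComparison f)) := h₂
  exact isIso_of_isIso _

/-- The category of quadruples is abelian: limits and colimits are computed componentwise. -/
instance abelian : Abelian (Quadruple B) := Abelian.ofCoimageImageComparisonIsIso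

instance : PreservesFiniteLimits (π B) := by
  rw [((π B).preservesFiniteLimits_tfae.out 3 2 :)]
  intro _ _ f
  infer_instance

instance : PreservesFiniteColimits (π B) := by
  rw [((π B).preservesFiniteColimits_tfae.out 3 2 :)]
  intro _ _ f
  infer_instance

end Quadruple

end

/-! ### The Serre quotient -/

/-- An exact functor `F` induces an equivalence of the Serre quotient by its kernel with its
target as soon as it is essentially surjective and every morphism `F(X) ⟶ F(Y)` is given by a
roof `X ⟵ Z ⟶ Y`. -/
lemma SerreQuotient.isEquivalence_lift {C D : Type*} [Category* C] [Abelian C] [Category* D]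
    [Abelian D] (P : ObjectProperty C) [P.IsSerreClass] (F : C ⥤ D) [PreservesFiniteLimits F]
    [PreservesFiniteColimits F] (hF : P.isoModSerre.IsInvertedBy F)
    (hP : ∀ X, IsZero (F.obj X) → P X) (h₁ : F.EssSurj)
    (h₂ : ∀ ⦃X Y : C⦄ (f : F.obj X ⟶ F.obj Y), ∃ (Z : C) (s : Z ⟶ X) (g : Z ⟶ Y),
      P.isoModSerre s ∧ F.map s ≫ f = F.map g) :
    (SerreQuotient.lift P F hF).IsEquivalence := by
  let L := P.isoModSerre.Q
  let G := SerreQuotient.lift P F hF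
  let e : L ⋙ G ≅ F := eqToIso (Localization.Construction.fac F hF)
  have hL : L.EssSurj := Localization.essSurj L P.isoModSerre
  have : F.Additive := F.additive_of_preserves_binary_products
  have : (L ⋙ G).Additive := Functor.additive_of_iso e.symm
  have : G.Additive := (Localization.functor_additive_iff L P.isoModSerre G).2 this
  -- If `F(f) = 0` then `F` vanishes on the image of `f`, so `f` vanishes in the Serre quotient.
  have hzero : ∀ ⦃X Y : C⦄ (f : X ⟶ Y), G.map (L.map f) = 0 → L.map f = 0 := by
    intro X Y f hf
    rw [ObjectProperty.SerreClassLocalization.map_eq_zero_iff L P]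
    apply hP
    have hf' : F.map f = 0 := by
      have := e.hom.naturality f
      rw [Functor.comp_map, hf, zero_comp] at this
      rw [← cancel_epi (e.hom.app X), ← this, comp_zero]
    rw [IsZero.iff_id_eq_zero, ← cancel_epi (F.map (Abelian.factorThruImage f)),
      ← cancel_mono (F.map (Abelian.image.ι f)), Category.comp_id, comp_zero, zero_comp,
      ← F.map_comp, Abelian.image.fac, hf']
  have hmap : ∀ ⦃X Y : C⦄ (f : L.obj X ⟶ L.obj Y), G.map f = 0 → f = 0 := by
    intro X Y f hf
    obtain ⟨φ, rfl⟩ := Localization.exists_rightFraction L P.isoModSerre f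
    have hs : IsIso (L.map φ.s) := Localization.inverts L P.isoModSerre φ.s φ.hs
    rw [← cancel_epi (L.map φ.s), comp_zero, MorphismProperty.RightFraction.map_s_comp_map]
    apply hzero
    rw [← MorphismProperty.RightFraction.map_s_comp_map φ L
      (Localization.inverts L P.isoModSerre), Functor.map_comp, hf, comp_zero]
  have : G.Faithful := ⟨by
    intro X Y f g hfg
    rw [← sub_eq_zero, ← cancel_epi (L.objObjPreimageIso X).hom,
      ← cancel_mono (L.objObjPreimageIso Y).inv, comp_zero, zero_comp]
    apply hmap
    rw [Functor.map_comp, Functor.map_comp, Functor.map_sub, hfg, sub_self, comp_zero,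
      zero_comp]⟩
  have : G.Full := ⟨by
    intro X Y f
    obtain ⟨Z, s, g, hs, h⟩ := h₂ (e.inv.app _ ≫ G.map (L.objObjPreimageIso X).hom ≫ f ≫
      G.map (L.objObjPreimageIso Y).inv ≫ e.hom.app _)
    have : IsIso (L.map s) := Localization.inverts L P.isoModSerre s hs
    refine ⟨(L.objObjPreimageIso X).inv ≫ inv (L.map s) ≫ L.map g ≫
      (L.objObjPreimageIso Y).hom, ?_⟩
    have key : G.map (L.map g) = G.map (L.map s) ≫ G.map (L.objObjPreimageIso X).hom ≫ f ≫
        G.map (L.objObjPreimageIso Y).inv := by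
      rw [← cancel_mono (e.hom.app _)]
      refine (e.hom.naturality g).trans ?_
      rw [← h]
      have n := e.hom.naturality s
      rw [Functor.comp_map] at n
      rw [← reassoc_of% n]
      simp only [Iso.hom_inv_id_app_assoc, Category.assoc]
    have h₁ : G.map (inv (L.map s)) ≫ G.map (L.map s) = 𝟙 _ := by
      rw [← Functor.map_comp, IsIso.inv_hom_id, CategoryTheory.Functor.map_id]
    have h₂ (W : SerreQuotient P) : G.map (L.objObjPreimageIso W).inv ≫
        G.map (L.objObjPreimageIso W).hom = 𝟙 _ := by
      rw [← Functor.map_comp, Iso.inv_hom_id, CategoryTheory.Functor.map_id]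
    rw [Functor.map_comp, Functor.map_comp, Functor.map_comp, key, Category.assoc,
      Category.assoc, Category.assoc, h₂, reassoc_of% h₁, reassoc_of% (h₂ X), Category.comp_id]⟩
  have : G.EssSurj := ⟨fun Y => ⟨L.obj (F.objPreimage Y),
    ⟨e.app _ ≪≫ F.objObjPreimageIso Y⟩⟩⟩
  exact { }

section

variable {A : Type u} [SmallCategory A] [Abelian A] (B : ObjectProperty A)
  [IsTwoStepSubcategory B] [(incl B).IsLeftAdjoint]

namespace Quadruple

open ZeroObject in
/-- A quadruple with `X = 0` has `u = 0` and `v = 0`, as `j̃(0) = 0`. -/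
lemma essImage_β : (β B).essImage = (π B).kernel := by
  ext S
  constructor
  · rintro ⟨Y, ⟨e⟩⟩
    exact (isZero_zero A).of_iso ((π B).mapIso e.symm)
  · intro h
    have h : IsZero S.X := h
    let f : (β B).obj S.Y ⟶ S := Hom.mk 0 (𝟙 _) (h.eq_of_tgt _ _)
      (((jTilde B).map_isZero (isZero_zero A)).eq_of_src _ _)
    have : IsIso f.fst := (isZero_zero A).isIso h _
    have : IsIso f.snd := inferInstanceAs (IsIso (𝟙 S.Y))
    have : IsIso f := isIso_of_isIso f
    exact ⟨S.Y, ⟨asIso f⟩⟩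

instance : (β B).essImage.IsSerreClass := by
  rw [essImage_β]
  infer_instance

lemma isInvertedBy_π : (β B).essImage.isoModSerre.IsInvertedBy (π B) := by
  rw [ObjectProperty.isoModSerre_isInvertedBy_iff, essImage_β]

/-- The quadruple given by `j̃(X) ⟶ j(X) ⟶ Z ⟶ X` for an admissible `Z ⊆ X`; the composition
`j̃(Z) ⟶ j̃(X) ⟶ Z` vanishes because it factors through `j(Z) = 0`. -/
def ofAdm {X : A} (Z : Adm B X) : Quadruple B where
  X := X
  Y := (Adm.diagram B X).obj Z
  u := Adm.arrow B Z
  v := (jTildeToJ B).app X ≫ jProj B Z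
  map_u_v := by
    have h : (jTilde B).map (Adm.arrow B Z) ≫ (jTildeToJ B).app X =
      (jTildeToJ B).app _ ≫ (j B).map (Adm.arrow B Z) := (jTildeToJ B).naturality _
    rw [← Category.assoc, h, Category.assoc,
      (isZero_j_obj B ((Adm.diagram B X).obj Z)).eq_of_src
        ((j B).map (Adm.arrow B Z) ≫ jProj B Z) 0, comp_zero]
  square := (jTildeCan_eq_compHom B X Z).symm

instance : (π B).EssSurj :=
  ⟨fun X => ⟨ofAdm B (Classical.arbitrary (Adm B X)), ⟨Iso.refl _⟩⟩⟩

variable {B}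

/-- Every morphism `f : X ⟶ X'` between the first components of quadruples `(X, Y, u, v)` and
`(X', Y', u', v')` is given by a roof: take the quadruple with first component `X` and second
component the subobject of `Y ⊕ Y'` where `f u = u'`, to which `v` and `v' j̃(f)` lift. -/
lemma exists_roof {S T : Quadruple B} (f : S.X ⟶ T.X) :
    ∃ (R : Quadruple B) (s : R ⟶ S) (g : R ⟶ T), IsIso s.fst ∧ s.fst ≫ f = g.fst := by
  obtain ⟨I, k, l, e, he, hk, hl⟩ := exists_common_subobject B (S.u ≫ f) T.u
  have sq := (IsPullback.of_hasPullback k l).map (Pro.of B.FullSubcategory)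
  have hu : (B.ι.map (pullback.fst k l) ≫ S.u) ≫ f = B.ι.map (pullback.snd k l) ≫ T.u := by
    rw [Category.assoc, ← hk, ← hl, ← Functor.map_comp_assoc, pullback.condition,
      Functor.map_comp_assoc]
  have hv : S.v ≫ (Pro.of B.FullSubcategory).map k =
      ((jTilde B).map f ≫ T.v) ≫ (Pro.of B.FullSubcategory).map l := by
    apply Pro.compHom_injective e
    rw [Pro.compHom_of_map, Pro.compHom_of_map, hk, hl, ← Pro.compHom_map, ← Pro.map_compHom,
      compHom_v_u, compHom_v_u, jTildeCan_naturality]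
  let R : Quadruple B :=
    { X := S.X
      Y := pullback k l
      u := B.ι.map (pullback.fst k l) ≫ S.u
      v := sq.lift S.v ((jTilde B).map f ≫ T.v) hv
      map_u_v := by
        apply sq.hom_ext
        · rw [Category.assoc, sq.lift_fst, Functor.map_comp, Category.assoc, S.map_u_v,
            comp_zero, zero_comp]
        · rw [Category.assoc, sq.lift_snd, ← Functor.map_comp_assoc, hu, Functor.map_comp,
            Category.assoc, T.map_u_v, comp_zero, zero_comp]
      square := by
        change Pro.compHom _ _ = jTildeCan B _
        rw [← Pro.compHom_of_map, sq.lift_fst, compHom_v_u] }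
  refine ⟨R, Hom.mk (𝟙 S.X) (pullback.fst k l) ?_ ?_, Hom.mk f (pullback.snd k l) ?_ ?_,
    ?_, Category.id_comp f⟩
  · exact (Category.comp_id _).symm
  · rw [CategoryTheory.Functor.map_id]
    exact (Category.id_comp _).trans (sq.lift_fst _ _ _).symm
  · exact hu.symm
  · exact (sq.lift_snd _ _ _).symm
  · exact inferInstanceAs (IsIso (𝟙 S.X))

variable (B)

lemma isEquivalence_lift_π :
    (SerreQuotient.lift (β B).essImage (π B) (isInvertedBy_π B)).IsEquivalence := by
  apply SerreQuotient.isEquivalence_lift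
  · intro S hS
    rw [essImage_β]
    exact hS
  · infer_instance
  · intro S T f
    obtain ⟨R, s, g, hs, h⟩ := exists_roof f
    refine ⟨R, s, g, ?_, h⟩
    simp only [essImage_β]
    rw [Abelian.isoModSerre_kernel_eq_inverseImage_isomorphisms]
    exact hs

end Quadruple

end

/-! ### Sheafification of presheaves of ind-objects -/

section

variable {A C : Type u} [SmallCategory A] [SmallCategory C]

variable (A C) in
/-- The functor sending a presheaf `H` of ind-objects to the family of presheaves
`c ↦ (X ↦ H(X)(c))`. -/
abbrev indSections : (Aᵒᵖ ⥤ Ind C) ⥤ (Cᵒᵖ ⥤ Aᵒᵖ ⥤ Type u) :=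
  (Functor.whiskeringRight Aᵒᵖ _ _).obj (Ind.inclusion C) ⋙ Functor.flipping.functor

variable [HasFiniteColimits C] (J : GrothendieckTopology A) (H : Aᵒᵖ ⥤ Ind C)

instance preservesFiniteLimits_indSections_obj :
    PreservesFiniteLimits ((indSections A C).obj H) :=
  preservesFiniteLimits_of_evaluation _ (fun X =>
    (isIndObject_iff_preservesFiniteLimits _).1 (Ind.isIndObject_inclusion_obj (H.obj X)))

/-- The pointwise sheafification of `c ↦ (X ↦ H(X)(c))`. -/
abbrev sheafifiedSections : Cᵒᵖ ⥤ Aᵒᵖ ⥤ Type u :=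
  (indSections A C).obj H ⋙ presheafToSheaf J (Type u) ⋙ sheafToPresheaf J (Type u)

/-- A presheaf on `C` is an ind-object as soon as it preserves finite limits; sheafification does,
and so do the sections of an ind-object. -/
lemma isIndObject_sheafifiedSections (X : Aᵒᵖ) :
    IsIndObject ((sheafifiedSections J H).flip.obj X) := by
  rw [isIndObject_iff_preservesFiniteLimits]
  exact inferInstanceAs (PreservesFiniteLimits
    (sheafifiedSections J H ⋙ (evaluation Aᵒᵖ (Type u)).obj X))

/-- The sheafification of a presheaf of ind-objects. Since sheafification is left exact, it can
be applied pointwise in `C`. -/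
def indSheafify : Aᵒᵖ ⥤ Ind C :=
  ObjectProperty.lift _ (sheafifiedSections J H).flip (isIndObject_sheafifiedSections J H) ⋙
    (Ind.equivalence C).inverse

/-- The sections of the sheafification of a presheaf of ind-objects. -/
def indSectionsSheafify : (indSections A C).obj (indSheafify J H) ≅ sheafifiedSections J H :=
  Functor.flipping.functor.mapIso
    (show indSheafify J H ⋙ Ind.inclusion C ≅ (sheafifiedSections J H).flip from
      Functor.isoWhiskerLeft (ObjectProperty.lift _ _ _)
        (Functor.isoWhiskerRight (Ind.equivalence C).counitIso (ObjectProperty.ι _)))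

/-- The unit of the sheafification of presheaves of ind-objects, on sections. -/
def toSheafifiedSections : (indSections A C).obj H ⟶ sheafifiedSections J H :=
  Functor.whiskerLeft ((indSections A C).obj H) (toSheafification J (Type u))

/-- The canonical morphism to the sheafification of a presheaf of ind-objects. -/
def toIndSheafify : H ⟶ indSheafify J H :=
  (indSections A C).preimage (toSheafifiedSections J H ≫ (indSectionsSheafify J H).inv)

lemma indSections_map_toIndSheafify : (indSections A C).map (toIndSheafify J H) =
    toSheafifiedSections J H ≫ (indSectionsSheafify J H).inv :=
  (indSections A C).map_preimage _

lemma isSheaf_indSheafify (c : Cᵒᵖ) :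
    Presheaf.IsSheaf J (((indSections A C).obj (indSheafify J H)).obj c) :=
  (Presheaf.isSheaf_of_iso_iff ((indSectionsSheafify J H).app c)).2
    ((presheafToSheaf J (Type u)).obj (((indSections A C).obj H).obj c)).property

lemma isLocallySurjective_toIndSheafify (c : Cᵒᵖ) :
    Presheaf.IsLocallySurjective J (((indSections A C).map (toIndSheafify J H)).app c) := by
  rw [indSections_map_toIndSheafify, NatTrans.comp_app]
  have : Presheaf.IsLocallySurjective J ((toSheafifiedSections J H).app c) :=
    inferInstanceAs (Presheaf.IsLocallySurjective J (toSheafify J _))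
  infer_instance

variable {H}

lemma toIndSheafify_hom_ext {H' : Aᵒᵖ ⥤ Ind C}
    (hH' : ∀ c, Presheaf.IsSheaf J (((indSections A C).obj H').obj c))
    {β β' : indSheafify J H ⟶ H'} (h : toIndSheafify J H ≫ β = toIndSheafify J H ≫ β') :
    β = β' := by
  apply (indSections A C).map_injective
  rw [← cancel_epi (indSectionsSheafify J H).inv]
  ext1
  funext c
  refine sheafify_hom_ext J _ _ (hH' c) ?_
  have h' := congr_app (congrArg (indSections A C).map h) c
  rw [Functor.map_comp, Functor.map_comp, indSections_map_toIndSheafify, Category.assoc,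
    Category.assoc] at h'
  exact h'

lemma exists_toIndSheafify_comp {H' : Aᵒᵖ ⥤ Ind C}
    (hH' : ∀ c, Presheaf.IsSheaf J (((indSections A C).obj H').obj c)) (α : H ⟶ H') :
    ∃ β : indSheafify J H ⟶ H', toIndSheafify J H ≫ β = α := by
  let α' := (indSections A C).map α
  let γ : sheafifiedSections J H ⟶ (indSections A C).obj H' :=
    { app c := sheafifyLift J (α'.app c) (hH' c)
      naturality c d f := by
        apply sheafify_hom_ext J _ _ (hH' d)
        rw [toSheafify_sheafifyLift_assoc, ← α'.naturality]
        refine (toSheafify_naturality_assoc J (((indSections A C).obj H).map f) _).symm.trans ?_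
        rw [toSheafify_sheafifyLift] }
  refine ⟨(indSections A C).preimage ((indSectionsSheafify J H).hom ≫ γ), ?_⟩
  apply (indSections A C).map_injective
  rw [Functor.map_comp, Functor.map_preimage, indSections_map_toIndSheafify, Category.assoc,
    Iso.inv_hom_id_assoc]
  ext1
  funext c
  exact toSheafify_sheafifyLift J _ _

end

/-! ### Right exact functors to pro-objects as sheaves -/

lemma effectiveEpi_of_epi {A : Type*} [Category* A] [Abelian A] {X Y : A} (f : X ⟶ Y) [Epi f] :
    EffectiveEpi f := by
  have : IsRegularEpi f := IsRegularEpiCategory.regularEpiOfEpi f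
  infer_instance

/-- Epimorphisms of an abelian category are stable under pullback, so they form the coverings of the
regular topology. -/
instance {A : Type*} [Category* A] [Abelian A] : Preregular A where
  exists_fac f g _ := ⟨_, pullback.fst f g, effectiveEpi_of_epi _, pullback.snd f g,
    pullback.condition.symm⟩

section

variable {A C : Type u} [SmallCategory A] [SmallCategory C]

/-- The presheaf `X ↦ Hom(G(X), c)` attached to a functor `G` to pro-objects and an object `c`. -/
abbrev homPresheaf (G : A ⥤ Pro C) (c : C) : Aᵒᵖ ⥤ Type u :=
  G.op ⋙ yoneda.obj ((Pro.of C).obj c)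

/-- The presheaves `Hom(G(-), c)` are the sections of the presheaf of ind-objects opposite
to `G`. -/
def homPresheafIso (G : A ⥤ Pro C) (c : C) :
    homPresheaf G c ≅ ((indSections A Cᵒᵖ).obj G.leftOp).obj (Opposite.op (Opposite.op c)) :=
  NatIso.ofComponents (fun X => Equiv.toIso
      { toFun := fun g => Quiver.Hom.unop g
        invFun := fun g => Quiver.Hom.op g
        left_inv := fun _ => rfl
        right_inv := fun _ => rfl } ≪≫ (indYonedaHomIso (Opposite.op c)).app (G.leftOp.obj X))
    (fun f => by
      have n := (indYonedaHomIso (Opposite.op c)).hom.naturality (G.leftOp.map f)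
      ext g
      exact congr($n g.unop))

/-- The identification of `Hom(G(X), c)` with sections is natural in `G`. -/
lemma homPresheafIso_naturality {G G' : A ⥤ Pro C} (α : G ⟶ G') (c : C) (X : A)
    (t : G'.obj X ⟶ (Pro.of C).obj c) :
    (homPresheafIso G c).hom.app (Opposite.op X) (α.app X ≫ t) =
      (((indSections A Cᵒᵖ).map (NatTrans.leftOp α)).app _).app (Opposite.op X)
        ((homPresheafIso G' c).hom.app (Opposite.op X) t) := by
  have n := (indYonedaHomIso (Opposite.op c)).hom.naturality
    ((NatTrans.leftOp α).app (Opposite.op X))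
  exact congr($n t.unop)

/-- The constant pro-objects are coseparating. -/
lemma pro_hom_ext {T T' : Pro C} {a b : T ⟶ T'}
    (h : ∀ (c : C) (t : T' ⟶ (Pro.of C).obj c), a ≫ t = b ≫ t) : a = b := by
  apply Quiver.Hom.unop_inj
  refine (Ind.isSeparating_range_yoneda (C := Cᵒᵖ)) _ _ ?_
  rintro _ ⟨c⟩ t
  exact congrArg Quiver.Hom.unop (h c.unop t.op)

end

section

variable {A C : Type u} [SmallCategory A] [Abelian A] [SmallCategory C]

/-- If the presheaves `Hom(R(-), c)` are sheaves, hence separated, then `R` preserves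
epimorphisms. -/
lemma epi_map_of_isSheaf (R : A ⥤ Pro C)
    (hR : ∀ c, Presheaf.IsSheaf (regularTopology A) (homPresheaf R c)) {X Y : A} (q : Y ⟶ X)
    [Epi q] : Epi (R.map q) where
  left_cancellation a b hab := by
    apply pro_hom_ext
    intro c t
    have h := hR c
    rw [← regularTopology.equalizerCondition_iff_isSheaf] at h
    have := effectiveEpi_of_epi q
    apply (h.bijective_mapToEqualizer_pullback q).injective
    apply Subtype.ext
    change R.map q ≫ a ≫ t = R.map q ≫ b ≫ t
    rw [reassoc_of% hab]

/-- If the presheaves `Hom(R(-), c)` are sheaves, then `R(q)` behaves like the coequalizer of the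
kernel pair of an epimorphism `q` for morphisms to constant pro-objects. -/
lemma exists_map_comp_eq_of_isSheaf (R : A ⥤ Pro C)
    (hR : ∀ c, Presheaf.IsSheaf (regularTopology A) (homPresheaf R c)) {X Y : A} (q : Y ⟶ X)
    [Epi q] {c : C} (t : R.obj Y ⟶ (Pro.of C).obj c)
    (ht : R.map (pullback.fst q q) ≫ t = R.map (pullback.snd q q) ≫ t) :
    ∃ s : R.obj X ⟶ (Pro.of C).obj c, R.map q ≫ s = t := by
  have h := hR c
  rw [← regularTopology.equalizerCondition_iff_isSheaf] at h
  have := effectiveEpi_of_epi q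
  obtain ⟨s, hs⟩ := (h.bijective_mapToEqualizer_pullback q).surjective ⟨t, ht⟩
  exact ⟨s, congrArg Subtype.val hs⟩

/-- A right exact functor `R` sends an epimorphism to the coequalizer of the image of its kernel
pair, which is the sheaf condition for `Hom(R(-), c)`. -/
lemma isSheaf_homPresheaf (R : A ⥤ Pro C) [PreservesFiniteColimits R] (c : C) :
    Presheaf.IsSheaf (regularTopology A) (homPresheaf R c) := by
  rw [← regularTopology.equalizerCondition_iff_isSheaf]
  apply regularTopology.EqualizerCondition.mk
  intro X Y p _ _
  have sq := IsKernelPair.of_hasPullback p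
  have : IsRegularEpi p := IsRegularEpiCategory.regularEpiOfEpi p
  have hp := isColimitCoforkMapOfIsColimit R _ sq.toCoequalizer'
  constructor
  · intro a b hab
    have hab' : R.map p ≫ a = R.map p ≫ b := congrArg Subtype.val hab
    exact (cancel_epi (R.map p)).1 hab'
  · rintro ⟨t, ht⟩
    have ht' : R.map (pullback.fst p p) ≫ t = R.map (pullback.snd p p) ≫ t := ht
    exact ⟨hp.desc (Cofork.ofπ t ht'), Subtype.ext (hp.fac (Cofork.ofπ t ht') .one)⟩

variable [Abelian C]

/-- The coreflection of a functor `A ⥤ Pro C` into right exact functors: the opposite of the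
sheafification for the topology of epimorphisms. -/
def coreflect (G : A ⥤ Pro C) : A ⥤ Pro C :=
  (indSheafify (regularTopology A) G.leftOp).rightOp

/-- The canonical morphism from the coreflection. -/
def coreflectCounit (G : A ⥤ Pro C) : coreflect G ⟶ G where
  app X := ((toIndSheafify (regularTopology A) G.leftOp).app (Opposite.op X)).op
  naturality _ _ f :=
    congrArg Quiver.Hom.op ((toIndSheafify (regularTopology A) G.leftOp).naturality f.op).symm

lemma isSheaf_homPresheaf_coreflect (G : A ⥤ Pro C) (c : C) :
    Presheaf.IsSheaf (regularTopology A) (homPresheaf (coreflect G) c) :=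
  (Presheaf.isSheaf_of_iso_iff (homPresheafIso (coreflect G) c)).2
    (isSheaf_indSheafify (regularTopology A) G.leftOp _)

/-- Morphisms from the coreflection of `G` to a constant pro-object come locally from `G`. -/
lemma exists_epi_comp_eq (G : A ⥤ Pro C) {X : A} {c : C}
    (s : (coreflect G).obj X ⟶ (Pro.of C).obj c) :
    ∃ (Y : A) (p : Y ⟶ X) (_ : Epi p) (t : G.obj Y ⟶ (Pro.of C).obj c),
      (coreflect G).map p ≫ s = (coreflectCounit G).app Y ≫ t := by
  have h := isLocallySurjective_toIndSheafify (regularTopology A) G.leftOp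
    (Opposite.op (Opposite.op c))
  have h' := Presheaf.imageSieve_mem (regularTopology A)
    (((indSections A Cᵒᵖ).map (toIndSheafify (regularTopology A) G.leftOp)).app
      (Opposite.op (Opposite.op c))) (U := Opposite.op X)
    ((homPresheafIso (coreflect G) c).hom.app (Opposite.op X) s)
  rw [regularTopology.mem_sieves_iff_hasEffectiveEpi] at h'
  obtain ⟨Y, p, _, t, ht⟩ := h'
  refine ⟨Y, p, inferInstance, (homPresheafIso G c).inv.app _ t, ?_⟩
  have n := homPresheafIso_naturality (coreflectCounit G) c Y ((homPresheafIso G c).inv.app _ t)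
  have n' := congr($((homPresheafIso (coreflect G) c).hom.naturality p.op) s)
  have e : (homPresheafIso G c).hom.app (Opposite.op Y) ((homPresheafIso G c).inv.app _ t) = t :=
    congr($((homPresheafIso G c).inv_hom_id_app (Opposite.op Y)) t)
  rw [e] at n
  apply (((homPresheafIso (coreflect G) c).app (Opposite.op Y)).toEquiv).injective
  exact n'.trans (ht.symm.trans n.symm)

/-- Exactness in the category of pro-objects can be tested on morphisms to constant
pro-objects. -/
lemma exact_of_exists_comp_eq (S : ShortComplex (Pro C))
    (h : ∀ (c : C) (t : S.X₂ ⟶ (Pro.of C).obj c), S.f ≫ t = 0 → ∃ s, S.g ≫ s = t) :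
    S.Exact := by
  rw [ShortComplex.exact_iff_mono_cokernel_desc, Preadditive.mono_iff_cancel_zero]
  intro T a ha
  apply pro_hom_ext
  intro c t
  obtain ⟨s, hs⟩ := h c (cokernel.π S.f ≫ t) (by rw [cokernel.condition_assoc, zero_comp])
  have hs' : t = cokernel.desc S.f S.g S.zero ≫ s := by
    rw [← cancel_epi (cokernel.π S.f), cokernel.π_desc_assoc, hs]
  rw [hs', reassoc_of% ha, zero_comp, zero_comp]

/-- An additive functor to pro-objects is right exact if the presheaves `Hom(R(-), c)` are sheaves
for the topology of epimorphisms. -/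
lemma preservesFiniteColimits_of_isSheaf (R : A ⥤ Pro C) [R.Additive]
    (hR : ∀ c, Presheaf.IsSheaf (regularTopology A) (homPresheaf R c)) :
    PreservesFiniteColimits R := by
  rw [(R.preservesFiniteColimits_tfae.out 3 0 :)]
  intro S hS
  have : Mono S.f := hS.mono_f
  have : Epi S.g := hS.epi_g
  have hl : (pullback.fst S.g S.g - pullback.snd S.g S.g) ≫ S.g = 0 := by
    rw [Preadditive.sub_comp, pullback.condition, sub_self]
  -- A morphism that kills `R(X₁)` coequalizes the kernel pair of `X₂ ⟶ X₃`.
  have key (c : C) (t : R.obj S.X₂ ⟶ (Pro.of C).obj c) (ht : R.map S.f ≫ t = 0) :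
      ∃ s : R.obj S.X₃ ⟶ (Pro.of C).obj c, R.map S.g ≫ s = t :=
    exists_map_comp_eq_of_isSheaf R hR S.g t (by
      rw [← sub_eq_zero, ← Preadditive.sub_comp, ← R.map_sub, ← hS.exact.lift_f _ hl,
        R.map_comp, Category.assoc, ht, comp_zero])
  exact ⟨exact_of_exists_comp_eq _ key, epi_map_of_isSheaf R hR S.g⟩

/-- Sheafification preserves additivity: the equation `Hom(f + g, c) = Hom(f, c) + Hom(g, c)` can be
tested on sections that come from `G`, after pulling back along an epimorphism. -/
instance (G : A ⥤ Pro C) [G.Additive] : (coreflect G).Additive where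
  map_add {X X'} f g := by
    apply pro_hom_ext
    intro c s
    obtain ⟨Y, p, _, t, ht⟩ := exists_epi_comp_eq G s
    -- After pulling back along the epimorphism `q`, both `f` and `g` factor through `p`.
    let q : pullback (pullback.fst f p ≫ g) p ⟶ X := pullback.fst _ _ ≫ pullback.fst f p
    let f' : pullback (pullback.fst f p ≫ g) p ⟶ Y := pullback.fst _ _ ≫ pullback.snd f p
    let g' : pullback (pullback.fst f p ≫ g) p ⟶ Y := pullback.snd _ _
    have hf : q ≫ f = f' ≫ p := by simp [q, f', pullback.condition]
    have hg : q ≫ g = g' ≫ p := by simp [q, g', pullback.condition]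
    have : Epi q := inferInstanceAs (Epi (_ ≫ _))
    have := epi_map_of_isSheaf _ (isSheaf_homPresheaf_coreflect G) q
    have key (k : X ⟶ X') (k' : _ ⟶ Y) (hk : q ≫ k = k' ≫ p) :
        (coreflect G).map q ≫ (coreflect G).map k ≫ s =
          (coreflectCounit G).app _ ≫ G.map k' ≫ t := by
      rw [← Functor.map_comp_assoc, hk, Functor.map_comp_assoc, ht, ← NatTrans.naturality_assoc]
    rw [← cancel_epi ((coreflect G).map q), key (f + g) (f' + g') (by simp [hf, hg]),
      Preadditive.add_comp, Preadditive.comp_add, key f f' hf, key g g' hg, G.map_add,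
      Preadditive.add_comp, Preadditive.comp_add]

instance (G : A ⥤ Pro C) [G.Additive] : PreservesFiniteColimits (coreflect G) :=
  preservesFiniteColimits_of_isSheaf _ (isSheaf_homPresheaf_coreflect G)

lemma coreflectCounit_hom_ext {G Q : A ⥤ Pro C} [PreservesFiniteColimits Q]
    {β β' : Q ⟶ coreflect G} (h : β ≫ coreflectCounit G = β' ≫ coreflectCounit G) :
    β = β' := by
  have hQ (c : (Cᵒᵖ)ᵒᵖ) : Presheaf.IsSheaf (regularTopology A)
      (((indSections A Cᵒᵖ).obj Q.leftOp).obj c) :=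
    (Presheaf.isSheaf_of_iso_iff (homPresheafIso Q c.unop.unop)).1 (isSheaf_homPresheaf Q _)
  have := toIndSheafify_hom_ext (regularTopology A) hQ (H := G.leftOp)
    (β := NatTrans.leftOp β) (β' := NatTrans.leftOp β') (by
      ext X
      exact congrArg Quiver.Hom.unop (congr_app h X.unop))
  ext X
  exact congrArg Quiver.Hom.op (congr_app this (Opposite.op X))

lemma exists_comp_coreflectCounit {G Q : A ⥤ Pro C} [PreservesFiniteColimits Q] (α : Q ⟶ G) :
    ∃ β : Q ⟶ coreflect G, β ≫ coreflectCounit G = α := by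
  have hQ (c : (Cᵒᵖ)ᵒᵖ) : Presheaf.IsSheaf (regularTopology A)
      (((indSections A Cᵒᵖ).obj Q.leftOp).obj c) :=
    (Presheaf.isSheaf_of_iso_iff (homPresheafIso Q c.unop.unop)).1 (isSheaf_homPresheaf Q _)
  obtain ⟨β, hβ⟩ := exists_toIndSheafify_comp (regularTopology A) hQ (NatTrans.leftOp α)
  refine ⟨{ app := fun X => (β.app (Opposite.op X)).op
            naturality := fun _ _ f => congrArg Quiver.Hom.op (β.naturality f.op).symm }, ?_⟩
  ext X
  exact congrArg Quiver.Hom.op (congr_app hβ (Opposite.op X))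

/-- Right exact functors to pro-objects are coreflective in additive functors. -/
lemma isLeftAdjoint_ofRightExact :
    (AdditiveFunctor.ofRightExact A (Pro C)).IsLeftAdjoint := by
  have (G : A ⥤+ Pro C) :
      HasTerminal (CostructuredArrow (AdditiveFunctor.ofRightExact A (Pro C)) G) := by
    have : G.obj.Additive := G.property
    let R : A ⥤ᵣ Pro C := RightExactFunctor.of (coreflect G.obj)
    let ε : (AdditiveFunctor.ofRightExact A (Pro C)).obj R ⟶ G :=
      ObjectProperty.homMk (coreflectCounit G.obj)
    have (Q : CostructuredArrow (AdditiveFunctor.ofRightExact A (Pro C)) G) :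
        Nonempty (Unique (Q ⟶ CostructuredArrow.mk ε)) := by
      have : PreservesFiniteColimits Q.left.obj := Q.left.property
      obtain ⟨β, hβ⟩ := exists_comp_coreflectCounit (G := G.obj) (Q := Q.left.obj) Q.hom.hom
      refine ⟨{ default := CostructuredArrow.homMk (ObjectProperty.homMk β) ?_, uniq := ?_ }⟩
      · ext1
        exact hβ
      · intro γ
        ext1
        ext1
        apply coreflectCounit_hom_ext
        refine Eq.trans ?_ hβ.symm
        exact congrArg (fun x => x.hom) (CostructuredArrow.w γ)
    have := fun Q => (this Q).some
    exact hasTerminal_of_unique (CostructuredArrow.mk ε)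
  exact isLeftAdjoint_of_costructuredArrowTerminals _

end

end Devissage

end

theorem proposition3p8 {A : Type u} [SmallCategory A] [Abelian A] (B : ObjectProperty A)
    [Devissage.IsTwoStepSubcategory B] :
    ∃ (_ : (Devissage.incl B).IsLeftAdjoint)
      (_ : Abelian (Devissage.Quadruple B))
      (_ : (Devissage.Quadruple.β B).essImage.IsSerreClass)
      (hπ : (Devissage.Quadruple.β B).essImage.isoModSerre.IsInvertedBy (Devissage.Quadruple.π B)),
      (Devissage.SerreQuotient.lift (Devissage.Quadruple.β B).essImage
        (Devissage.Quadruple.π B) hπ).IsEquivalence := by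
  have : (Devissage.incl B).IsLeftAdjoint := Devissage.isLeftAdjoint_ofRightExact
  exact ⟨this, Devissage.Quadruple.abelian, inferInstance, Devissage.Quadruple.isInvertedBy_π B,
    Devissage.Quadruple.isEquivalence_lift_π B⟩
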